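/- Let $(\mathcal V,\otimes,I)$ be a bicomplete symmetric monoidal closed category, and let $F:\mathrm{Set}\to\mathcal V$ send a set $A$ to the coproduct $\coprod_{A} I$. For a set $S$, let $\mathcal V\mathrm{Quiv}_S$ be the category of families $Q=(Q(a,b))_{a,b\in S}$ of objects of $\mathcal V$, with families of morphisms between them. It is monoidal with $(Q\otimes_S P)(a,b)=\coprod_{c\in S}Q(a,c)\otimes P(c,b)$ and unit $I_S$, where $I_S(a,b)=I$ if $a=b$ and $I_S(a,b)=0$ (the initial object) if $a\ne b$. Let $\Delta_f$ be the category of finite intervals: its objects are the posets $[n]=\{0<\dots<n\}$, $n\ge 0$, its morphisms are the order morphisms $f:[m]\to[n]$ with $f(0)=0$ and $f(m)=n$, and it is monoidal with unit $[0]$ and $[m]+[n]=[m+n]$ (glue the top endpoint of $[m]$ to the bottom endpoint of $[n]$). **Templicial objects.** A templicial object $(X,S)$ in $\mathcal V$ is a set $S$ with a colax monoidal functor $X:\Delta_f^{op}\to\mathcal V\mathrm{Quiv}_S$, $[n]\mapsto X_n$, whose counit $X_0\to I_S$ is an isomorphism. For $n\ge0$ put $X^{deg}_n=\mathrm{colim}\,X_k$,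 where the colimit runs over the surjective order morphisms $[n]\twoheadrightarrow[k]$ with $k<n$ (and the surjections under $[n]$ between them). One says that $X$ has non-degenerate simplices if for every $n\ge 0$ there is a quiver $X^{nd}_n$ such that the canonical morphism $X^{deg}_n\to X_n$ is isomorphic to the coprojection $X^{deg}_n\to X^{deg}_n\amalg X^{nd}_n$; a choice of the $X^{nd}_n$ is then fixed. **Necklaces.** A necklace is a pair $(T,p)$ with $p\ge0$ and $\{0,p\}\subseteq T\subseteq[p]$; a morphism $(T,p)\to(U,q)$ is a morphism $f:[p]\to[q]$ of $\Delta_f$ with $U\subseteq f(T)$. Let $\mathcal N$ be the category of necklaces. For $T=\{0=t_0<t_1<\dots<t_k=p\}$ set $$X_T=X_{t_1}\otimes_S X_{t_2-t_1}\otimes_S\dots\otimes_S X_{p-t_{k-1}},\qquad X^{nd}_T=X^{nd}_{t_1}\otimes_S X^{nd}_{t_2-t_1}\otimes_S\dots\otimes_S X^{nd}_{p-t_{k-1}},$$ both being $I_S$ if $k=0$. The assignment $T\mapsto X_T$ is a functor $\mathcal N^{op}\to\mathcal V\mathrm{Quiv}_S$: a morphism $f:(T,p)\to(U,q)$ acts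 as the composite $X_U\to X_{f(T)}\to X_T$, where $X_U\to X_{f(T)}$ is given by the comultiplications of $X$, and $X_{f(T)}\to X_T$ is given by the restrictions of $f$ to the intervals between consecutive elements of $T$ (with $I_S\cong X_0$ inserted for each such interval that $f$ maps to a point). **Flags.** For a necklace $(T,p)$ let $\mathcal P_T=\{U\mid T\subseteq U\subseteq[p]\}$, ordered by inclusion; it is functorial in $T$ through $U\mapsto f(U)$. A flag of length $n$ on $T$ is an $n$-simplex of the nerve $N\mathcal P_T$, that is, a sequence $\vec T=(T_0\subseteq T_1\subseteq\dots\subseteq T_n)$ in $\mathcal P_T$. It is flanked if $T_0=T$ and $T_n=[p]$. **Categorification.** For $a,b\in S$ the hom-object $\mathfrak C_{\mathcal V}[X](a,b)$ is the simplicial object of $\mathcal V$ obtained as the colimit of $T\mapsto FN\mathcal P_T$ weighted by $T\mapsto X_T(a,b)$, i.e. the coequaliser $$\coprod_{f:T\to U\text{ in }\mathcal N}X_U(a,b)\otimes FN\mathcal P_T\rightrightarrows\coprod_{T\in\mathcal N}X_T(a,b)\otimes FN\mathcal P_T\to\mathfrak C_{\mathcal V}[X](a,b)$$ of the morphisms induced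 by $X_U(a,b)\to X_T(a,b)$ and by $FN\mathcal P_T\to FN\mathcal P_U$. **Proposition.** Let $(X,S)$ be a templicial object in $\mathcal V$ with non-degenerate simplices. For all $n\ge 0$ and $a,b\in S$ there is an isomorphism in $\mathcal V$ $$\mathfrak C_{\mathcal V}[X]_n(a,b)\;\cong\;\coprod_{\substack{T\in\mathcal N,\\ \vec T\text{ flanked flag on }T\text{ of length }n}}X^{nd}_T(a,b).$$ -/

import Mathlib

open CategoryTheory Limits MonoidalCategory Opposite

universe v u

noncomputable section

namespace Templicial




/-- Objects `[n]` of the category of finite intervals. -/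
@[ext]
structure FinInt where
  len : ℕ

namespace FinInt

@[ext]
structure Hom (m n : FinInt) where
  toOrderHom : Fin (m.len + 1) →o Fin (n.len + 1)
  map_zero : toOrderHom 0 = 0
  map_last : toOrderHom (Fin.last _) = Fin.last _

instance : Category FinInt where
  Hom := Hom
  id m := ⟨OrderHom.id, rfl, rfl⟩
  comp f g := ⟨g.toOrderHom.comp f.toOrderHom, by simp [f.map_zero, g.map_zero],
    by simp [f.map_last, g.map_last]⟩

/-- The underlying map of vertices, extended to all natural numbers by the constant value at
the last vertex. -/
def ev {m n : FinInt} (f : m ⟶ n) (i : ℕ) : ℕ :=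
  (f.toOrderHom ⟨min i m.len, by omega⟩ : ℕ)

variable {l m n k : FinInt}

lemma ev_mono (f : m ⟶ n) : Monotone (ev f) := fun i j h =>
  f.toOrderHom.monotone (by simp only [Fin.mk_le_mk]; omega)

@[simp] lemma ev_zero (f : m ⟶ n) : ev f 0 = 0 := by
  have := congrArg Fin.val f.map_zero
  simpa [ev] using this

lemma ev_of_le (f : m ⟶ n) {i : ℕ} (h : m.len ≤ i) : ev f i = n.len := by
  have := congrArg Fin.val f.map_last
  simpa [ev, Fin.last, min_eq_right h] using this

lemma ev_le (f : m ⟶ n) (i : ℕ) : ev f i ≤ n.len := by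
  unfold ev; omega

lemma ev_fin (f : m ⟶ n) (i : Fin (m.len + 1)) : ev f i = f.toOrderHom i := by
  have h : min (i : ℕ) m.len = i := by omega
  simp [ev, h]

lemma hom_ext {f g : m ⟶ n} (h : ∀ i ≤ m.len, ev f i = ev g i) : f = g := by
  apply Hom.ext
  ext i
  have := h i (by omega)
  rwa [ev_fin, ev_fin] at this

/-- A morphism from a function on natural numbers. -/
def homMk (φ : ℕ → ℕ) (hφ : ∀ i j, i ≤ j → j ≤ m.len → φ i ≤ φ j) (h0 : φ 0 = 0)
    (h1 : φ m.len = n.len) : m ⟶ n where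
  toOrderHom :=
    { toFun i := ⟨φ i, by have := hφ i m.len (by omega) le_rfl; omega⟩
      monotone' i j h := by
        simp only [Fin.mk_le_mk]; exact hφ _ _ h (by omega) }
  map_zero := Fin.ext h0
  map_last := Fin.ext h1

lemma ev_homMk (φ : ℕ → ℕ) (hφ : ∀ i j, i ≤ j → j ≤ m.len → φ i ≤ φ j) (h0 : φ 0 = 0)
    (h1 : φ m.len = n.len) (i : ℕ) : ev (homMk (n := n) φ hφ h0 h1) i = φ (min i m.len) := rfl

lemma ev_id (i : ℕ) : ev (𝟙 m) i = min i m.len := rfl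

lemma ev_comp (f : m ⟶ n) (g : n ⟶ k) (i : ℕ) : ev (f ≫ g) i = ev g (ev f i) := by
  have : ev f i = f.toOrderHom ⟨min i m.len, by omega⟩ := rfl
  rw [this, ev_fin]; rfl

/-- The sum `f + g` of morphisms, gluing the last vertex of the first interval to the first vertex
of the second one. -/
def addHom {m m' n n' : FinInt} (f : m ⟶ m') (g : n ⟶ n') :
    (⟨m.len + n.len⟩ : FinInt) ⟶ ⟨m'.len + n'.len⟩ :=
  homMk (fun i => if i ≤ m.len then ev f i else m'.len + ev g (i - m.len))
    (fun i j hij _ => by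
      have h1 := ev_mono f hij
      have h2 := ev_mono g (show i - m.len ≤ j - m.len by omega)
      have h3 := ev_le f i
      split_ifs <;> omega)
    (by simp)
    (by
      have h1 := ev_of_le f le_rfl
      have h2 := ev_of_le g le_rfl
      have h3 := ev_zero g
      have h5 := fun h => ev_of_le f (i := m.len + n.len) h
      have h4 := fun h => ev_of_le g (i := 0) h
      simp only [Nat.add_sub_cancel_left]
      split_ifs <;> grind)

lemma ev_addHom {m m' n n' : FinInt} (f : m ⟶ m') (g : n ⟶ n') (i : ℕ) :
    ev (addHom f g) i = if i ≤ m.len then ev f i else m'.len + ev g (i - m.len) := by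
  rcases le_total i (m.len + n.len) with h | h
  · refine (ev_homMk _ _ _ _ i).trans ?_
    rw [min_eq_left h]
  · rw [ev_of_le _ h]
    have h2 := fun h => ev_of_le g (i := i - m.len) h
    have h3 := ev_zero g
    have h5 := fun h => ev_of_le f (i := i) h
    have h4 := fun h => ev_of_le g (i := 0) h
    split_ifs <;> grind

/-- Reindexing along an equality of lengths. -/
def castIso {m n : FinInt} (h : m.len = n.len) : m ≅ n where
  hom := homMk id (fun _ _ h _ => h) rfl h
  inv := homMk id (fun _ _ h _ => h) rfl h.symm
  hom_inv_id := hom_ext fun i hi => by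
    simp only [ev_comp, ev_id, ev_homMk, id]; omega
  inv_hom_id := hom_ext fun i hi => by
    simp only [ev_comp, ev_id, ev_homMk, id]; omega

instance : MonoidalCategoryStruct FinInt where
  tensorObj m n := ⟨m.len + n.len⟩
  whiskerLeft m _ _ g := addHom (𝟙 m) g
  whiskerRight f n := addHom f (𝟙 n)
  tensorHom f g := addHom f g
  tensorUnit := ⟨0⟩
  associator _ _ _ := castIso (Nat.add_assoc _ _ _)
  leftUnitor _ := castIso (Nat.zero_add _)
  rightUnitor _ := castIso (Nat.add_zero _)

lemma tensor_len (m n : FinInt) : (m ⊗ n).len = m.len + n.len := rfl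
lemma unit_len : (𝟙_ FinInt).len = 0 := rfl

lemma ev_tensorHom {m m' n n' : FinInt} (f : m ⟶ m') (g : n ⟶ n') (i : ℕ) :
    ev (f ⊗ₘ g) i = if i ≤ m.len then ev f i else m'.len + ev g (i - m.len) :=
  ev_addHom f g i

lemma ev_whiskerRight {m m' : FinInt} (f : m ⟶ m') (n : FinInt) (i : ℕ) :
    ev (f ▷ n) i = if i ≤ m.len then ev f i else m'.len + min (i - m.len) n.len :=
  ev_addHom f (𝟙 n) i

lemma ev_whiskerLeft (m : FinInt) {n n' : FinInt} (g : n ⟶ n') (i : ℕ) :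
    ev (m ◁ g) i = if i ≤ m.len then i else m.len + ev g (i - m.len) := by
  refine (ev_addHom (𝟙 m) g i).trans ?_
  split_ifs with h
  · rw [ev_id, min_eq_left h]
  · rfl

lemma ev_associator_hom (l m n : FinInt) (i : ℕ) :
    ev (α_ l m n).hom i = min i (l.len + m.len + n.len) := rfl
lemma ev_associator_inv (l m n : FinInt) (i : ℕ) :
    ev (α_ l m n).inv i = min i (l.len + (m.len + n.len)) := rfl
lemma ev_leftUnitor_hom (n : FinInt) (i : ℕ) : ev (λ_ n).hom i = min i (0 + n.len) := rfl
lemma ev_leftUnitor_inv (n : FinInt) (i : ℕ) : ev (λ_ n).inv i = min i n.len := rfl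
lemma ev_rightUnitor_hom (n : FinInt) (i : ℕ) : ev (ρ_ n).hom i = min i (n.len + 0) := rfl
lemma ev_rightUnitor_inv (n : FinInt) (i : ℕ) : ev (ρ_ n).inv i = min i n.len := rfl

instance : MonoidalCategory FinInt where
  tensorHom_def f g := hom_ext fun i hi => by
    have h1 := ev_le f i
    have h2 := ev_of_le f (i := i)
    have h3 := ev_zero g
    simp only [ev_comp, ev_tensorHom, ev_whiskerLeft, ev_whiskerRight, tensor_len] at *
    split_ifs <;> grind
  id_tensorHom_id m n := hom_ext fun i hi => by
    simp only [ev_tensorHom, ev_id, tensor_len] at *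
    split_ifs <;> omega
  tensorHom_comp_tensorHom {X₁ Y₁ Z₁ X₂ Y₂ Z₂} f g h k := hom_ext fun i hi => by
    have h1 := ev_le f i
    have h2 := ev_of_le h (i := Y₁.len)
    have h3 := ev_zero k
    simp only [ev_comp, ev_tensorHom, tensor_len] at *
    split_ifs <;> grind
  whiskerLeft_id m n := hom_ext fun i hi => by
    simp only [ev_whiskerLeft, ev_id, tensor_len] at *
    split_ifs <;> omega
  id_whiskerRight m n := hom_ext fun i hi => by
    simp only [ev_whiskerRight, ev_id, tensor_len] at *
    split_ifs <;> omega
  associator_naturality {X₁ X₂ X₃ Y₁ Y₂ Y₃} f g h := hom_ext fun i hi => by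
    have h1 := ev_le f i
    have h2 := ev_le g (i - X₁.len)
    have h3 := ev_le h (i - X₁.len - X₂.len)
    have h4 : i - (X₁.len + X₂.len) = i - X₁.len - X₂.len := by omega
    simp only [ev_comp, ev_tensorHom, ev_associator_hom, tensor_len, h4] at *
    rw [min_eq_left hi]
    split_ifs <;> omega
  leftUnitor_naturality {X Y} f := hom_ext fun i hi => by
    have h1 := ev_le f i
    have h2 := ev_zero f
    simp only [ev_comp, ev_whiskerLeft, ev_leftUnitor_hom, tensor_len, unit_len] at *
    rw [min_eq_left hi]
    split_ifs <;> grind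
  rightUnitor_naturality {X Y} f := hom_ext fun i hi => by
    have h1 := ev_le f i
    simp only [ev_comp, ev_whiskerRight, ev_rightUnitor_hom, tensor_len, unit_len] at *
    rw [min_eq_left hi]
    split_ifs <;> omega
  pentagon k l m n := hom_ext fun i hi => by
    simp only [ev_comp, ev_whiskerRight, ev_whiskerLeft, ev_associator_hom, tensor_len] at *
    split_ifs <;> omega
  triangle m n := hom_ext fun i hi => by
    simp only [ev_comp, ev_whiskerRight, ev_whiskerLeft, ev_associator_hom, ev_leftUnitor_hom,
      ev_rightUnitor_hom, tensor_len, unit_len] at *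
    split_ifs <;> omega

end FinInt

set_option linter.unusedSectionVars false

section SigmaTensor

variable {V : Type u} [Category.{v} V] [MonoidalCategory V] [SymmetricCategory V]
  [MonoidalClosed V] [HasColimits V]

instance tensorRight_preserves (R : V) : PreservesColimitsOfSize.{v, v} (tensorRight R) :=
  preservesColimits_of_natIso (BraidedCategory.tensorLeftIsoTensorRight R)

variable {ι : Type v} {F : ι → V} {R Z : V}

/-- Morphisms out of `(∐ F) ⊗ R`. -/
def descRight (φ : ∀ i, F i ⊗ R ⟶ Z) : (∐ F) ⊗ R ⟶ Z :=
  (isColimitCofanMkObjOfIsColimit (tensorRight R) F _ (coproductIsCoproduct F)).desc (Cofan.mk Z φ)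

@[simp] lemma ι_descRight (φ : ∀ i, F i ⊗ R ⟶ Z) (i : ι) :
    Sigma.ι F i ▷ R ≫ descRight φ = φ i :=
  (isColimitCofanMkObjOfIsColimit (tensorRight R) F _ (coproductIsCoproduct F)).fac
    (Cofan.mk Z φ) ⟨i⟩

lemma right_hom_ext {f g : (∐ F) ⊗ R ⟶ Z} (h : ∀ i, Sigma.ι F i ▷ R ≫ f = Sigma.ι F i ▷ R ≫ g) :
    f = g :=
  (isColimitCofanMkObjOfIsColimit (tensorRight R) F _ (coproductIsCoproduct F)).hom_ext
    fun ⟨i⟩ => h i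

/-- Morphisms out of `R ⊗ (∐ F)`. -/
def descLeft (φ : ∀ i, R ⊗ F i ⟶ Z) : R ⊗ (∐ F) ⟶ Z :=
  (isColimitCofanMkObjOfIsColimit (tensorLeft R) F _ (coproductIsCoproduct F)).desc (Cofan.mk Z φ)

@[simp] lemma ι_descLeft (φ : ∀ i, R ⊗ F i ⟶ Z) (i : ι) :
    R ◁ Sigma.ι F i ≫ descLeft φ = φ i :=
  (isColimitCofanMkObjOfIsColimit (tensorLeft R) F _ (coproductIsCoproduct F)).fac
    (Cofan.mk Z φ) ⟨i⟩

lemma left_hom_ext {f g : R ⊗ (∐ F) ⟶ Z} (h : ∀ i, R ◁ Sigma.ι F i ≫ f = R ◁ Sigma.ι F i ≫ g) :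
    f = g :=
  (isColimitCofanMkObjOfIsColimit (tensorLeft R) F _ (coproductIsCoproduct F)).hom_ext
    fun ⟨i⟩ => h i

end SigmaTensor

/-- `V`-enriched quivers with set of vertices `S`. -/
@[ext]
structure VQuiv (V : Type u) (S : Type v) where
  obj : S → S → V

namespace VQuiv

variable {V : Type u} [Category.{v} V] {S : Type v}

/-- Quiver morphisms that are the identity on vertices. -/
@[ext]
structure Hom (P Q : VQuiv V S) where
  app : ∀ a b : S, P.obj a b ⟶ Q.obj a b

instance : Category (VQuiv V S) where
  Hom := Hom
  id P := ⟨fun a b => 𝟙 (P.obj a b)⟩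
  comp f g := ⟨fun a b => f.app a b ≫ g.app a b⟩

@[ext] lemma hom_ext {P Q : VQuiv V S} {f g : P ⟶ Q} (h : ∀ a b, f.app a b = g.app a b) : f = g :=
  Hom.ext (by funext a b; exact h a b)

@[simp] lemma id_app (P : VQuiv V S) (a b : S) : Hom.app (𝟙 P) a b = 𝟙 (P.obj a b) := rfl
@[simp] lemma comp_app {P Q R : VQuiv V S} (f : P ⟶ Q) (g : Q ⟶ R) (a b : S) :
    Hom.app (f ≫ g) a b = f.app a b ≫ g.app a b := rfl

variable (V) in
/-- Evaluation of quivers at a pair of vertices. -/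
@[simps]
def eval (a b : S) : VQuiv V S ⥤ V where
  obj P := P.obj a b
  map f := f.app a b

/-- Isomorphisms of quivers are given componentwise. -/
@[simps]
def isoMk {P Q : VQuiv V S} (e : ∀ a b, P.obj a b ≅ Q.obj a b) : P ≅ Q where
  hom := ⟨fun a b => (e a b).hom⟩
  inv := ⟨fun a b => (e a b).inv⟩

section Colimits

universe w w'

variable {J : Type*} [Category* J] [HasColimitsOfShape J V] (D : J ⥤ VQuiv V S)

/-- Colimits of quivers are computed for each pair of vertices separately. -/
def colimitCocone : ColimitCocone D where
  cocone :=
    { pt := ⟨fun a b => colimit (D ⋙ eval V a b)⟩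
      ι :=
        { app j := ⟨fun a b => colimit.ι (D ⋙ eval V a b) j⟩
          naturality i j f := by
            ext a b
            have := colimit.w (D ⋙ eval V a b) f
            simp at this ⊢
            exact this } }
  isColimit :=
    { desc s := ⟨fun a b => colimit.desc (D ⋙ eval V a b) ((eval V a b).mapCocone s)⟩
      fac s j := by ext a b; exact colimit.ι_desc _ _
      uniq s m hm := by
        refine hom_ext fun a b => colimit.hom_ext fun j => ?_
        exact (congrArg (fun f => Hom.app f a b) (hm j)).trans
          (colimit.ι_desc (F := D ⋙ eval V a b) ((eval V a b).mapCocone s) j).symm }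

instance : HasColimitsOfShape J (VQuiv V S) := ⟨fun D => ⟨⟨colimitCocone D⟩⟩⟩

instance [HasColimitsOfSize.{w, w'} V] : HasColimitsOfSize.{w, w'} (VQuiv V S) := ⟨inferInstance⟩

end Colimits

section Monoidal

variable [MonoidalCategory V] [SymmetricCategory V] [MonoidalClosed V] [HasColimits V]

/-- The tensor product `(P ⊗ Q)(a, b) = ∐_c P(a, c) ⊗ Q(c, b)`. -/
abbrev tensor (P Q : VQuiv V S) : VQuiv V S := ⟨fun a b => ∐ fun c => P.obj a c ⊗ Q.obj c b⟩

/-- The unit, with `I_S(a, b)` a coproduct of copies of `I` indexed by the proofs of `a = b`, that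
is `I` if `a = b` and an initial object otherwise. -/
abbrev unit : VQuiv V S := ⟨fun a b => ∐ fun _ : ULift.{v} (PLift (a = b)) => 𝟙_ V⟩

/-- The inclusion of `I` in `I_S(a, a)`. -/
abbrev unitinc (a : S) : 𝟙_ V ⟶ (unit (V := V) (S := S)).obj a a :=
  Sigma.ι (fun _ : ULift.{v} (PLift (a = a)) => 𝟙_ V) ⟨⟨rfl⟩⟩

/-- The inclusion of the summand at `c` of `P ⊗ Q`. -/
abbrev inc (P Q : VQuiv V S) (a c b : S) : P.obj a c ⊗ Q.obj c b ⟶ (tensor P Q).obj a b :=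
  Sigma.ι (fun c => P.obj a c ⊗ Q.obj c b) c

lemma tensor_ext {P Q : VQuiv V S} {a b : S} {Z : V} {f g : (tensor P Q).obj a b ⟶ Z}
    (h : ∀ c, inc P Q a c b ≫ f = inc P Q a c b ≫ g) : f = g :=
  Sigma.hom_ext _ _ h

def whiskL (P : VQuiv V S) {Q Q' : VQuiv V S} (g : Q ⟶ Q') : tensor P Q ⟶ tensor P Q' :=
  ⟨fun a b => Limits.Sigma.map fun c => P.obj a c ◁ g.app c b⟩

def whiskR {P P' : VQuiv V S} (f : P ⟶ P') (Q : VQuiv V S) : tensor P Q ⟶ tensor P' Q :=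
  ⟨fun a b => Limits.Sigma.map fun c => f.app a c ▷ Q.obj c b⟩

def homTensor {P P' Q Q' : VQuiv V S} (f : P ⟶ P') (g : Q ⟶ Q') : tensor P Q ⟶ tensor P' Q' :=
  ⟨fun a b => Limits.Sigma.map fun c => f.app a c ⊗ₘ g.app c b⟩

def assocHom (P Q R : VQuiv V S) : tensor (tensor P Q) R ⟶ tensor P (tensor Q R) :=
  ⟨fun a b => Sigma.desc fun d => descRight fun c =>
    (α_ (P.obj a c) (Q.obj c d) (R.obj d b)).hom ≫ P.obj a c ◁ inc Q R c d b ≫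
      inc P (tensor Q R) a c b⟩

def assocInv (P Q R : VQuiv V S) : tensor P (tensor Q R) ⟶ tensor (tensor P Q) R :=
  ⟨fun a b => Sigma.desc fun c => descLeft fun d =>
    (α_ (P.obj a c) (Q.obj c d) (R.obj d b)).inv ≫ inc P Q a c d ▷ R.obj d b ≫
      inc (tensor P Q) R a d b⟩

@[simp] lemma inc_assocHom (P Q R : VQuiv V S) (a c d b : S) :
    inc P Q a c d ▷ R.obj d b ≫ inc (tensor P Q) R a d b ≫ (assocHom P Q R).app a b =
    (α_ (P.obj a c) (Q.obj c d) (R.obj d b)).hom ≫ P.obj a c ◁ inc Q R c d b ≫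
      inc P (tensor Q R) a c b := by
  simp [assocHom]

@[simp] lemma inc_assocInv (P Q R : VQuiv V S) (a c d b : S) :
    P.obj a c ◁ inc Q R c d b ≫ inc P (tensor Q R) a c b ≫ (assocInv P Q R).app a b =
    (α_ (P.obj a c) (Q.obj c d) (R.obj d b)).inv ≫ inc P Q a c d ▷ R.obj d b ≫
      inc (tensor P Q) R a d b := by
  simp [assocInv]

def lamHom (P : VQuiv V S) : tensor unit P ⟶ P :=
  ⟨fun a b => Sigma.desc fun c => descRight fun h =>
    (λ_ (P.obj c b)).hom ≫ eqToHom (by rw [h.down.down])⟩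

def lamInv (P : VQuiv V S) : P ⟶ tensor unit P :=
  ⟨fun a b => (λ_ (P.obj a b)).inv ≫ unitinc a ▷ P.obj a b ≫ inc unit P a a b⟩

@[simp] lemma unitinc_lamHom (P : VQuiv V S) (a b : S) :
    unitinc a ▷ P.obj a b ≫ inc unit P a a b ≫ (lamHom P).app a b = (λ_ (P.obj a b)).hom := by
  simp [lamHom]

def rhoHom (P : VQuiv V S) : tensor P unit ⟶ P :=
  ⟨fun a b => Sigma.desc fun c => descLeft fun h =>
    (ρ_ (P.obj a c)).hom ≫ eqToHom (by rw [h.down.down])⟩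

def rhoInv (P : VQuiv V S) : P ⟶ tensor P unit :=
  ⟨fun a b => (ρ_ (P.obj a b)).inv ≫ P.obj a b ◁ unitinc b ≫ inc P unit a b b⟩

@[simp] lemma unitinc_rhoHom (P : VQuiv V S) (a b : S) :
    P.obj a b ◁ unitinc b ≫ inc P unit a b b ≫ (rhoHom P).app a b = (ρ_ (P.obj a b)).hom := by
  simp [rhoHom]

lemma tensor3_ext {P Q R : VQuiv V S} {a b : S} {Z : V}
    {f g : (tensor (tensor P Q) R).obj a b ⟶ Z}
    (h : ∀ c d, inc P Q a c d ▷ R.obj d b ≫ inc (tensor P Q) R a d b ≫ f =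
      inc P Q a c d ▷ R.obj d b ≫ inc (tensor P Q) R a d b ≫ g) : f = g :=
  tensor_ext fun d => right_hom_ext fun c => h c d

lemma tensor3_ext' {P Q R : VQuiv V S} {a b : S} {Z : V}
    {f g : (tensor P (tensor Q R)).obj a b ⟶ Z}
    (h : ∀ c d, P.obj a c ◁ inc Q R c d b ≫ inc P (tensor Q R) a c b ≫ f =
      P.obj a c ◁ inc Q R c d b ≫ inc P (tensor Q R) a c b ≫ g) : f = g :=
  tensor_ext fun c => left_hom_ext fun d => h c d

lemma tensor4_ext {P Q R T : VQuiv V S} {a b : S} {Z : V}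
    {f g : (tensor (tensor (tensor P Q) R) T).obj a b ⟶ Z}
    (h : ∀ c d e, inc P Q a c d ▷ R.obj d e ▷ T.obj e b ≫
      inc (tensor P Q) R a d e ▷ T.obj e b ≫ inc (tensor (tensor P Q) R) T a e b ≫ f =
      inc P Q a c d ▷ R.obj d e ▷ T.obj e b ≫
      inc (tensor P Q) R a d e ▷ T.obj e b ≫ inc (tensor (tensor P Q) R) T a e b ≫ g) : f = g := by
  refine tensor3_ext fun d e => ?_
  rw [← cancel_epi (α_ _ _ _).inv]
  refine right_hom_ext fun c => ?_
  have := h c d e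
  rw [← cancel_epi (α_ _ _ _).inv] at this
  simpa only [whiskerRight_tensor, Category.assoc, Iso.hom_inv_id_assoc] using this

lemma unit_tensor_ext {P : VQuiv V S} {a b : S} {Z : V}
    {f g : (tensor unit P).obj a b ⟶ Z}
    (h : unitinc a ▷ P.obj a b ≫ inc unit P a a b ≫ f =
      unitinc a ▷ P.obj a b ≫ inc unit P a a b ≫ g) : f = g :=
  tensor_ext fun c => right_hom_ext fun ⟨⟨hc⟩⟩ => by subst hc; exact h

lemma tensor_unit_ext {P : VQuiv V S} {a b : S} {Z : V}
    {f g : (tensor P unit).obj a b ⟶ Z}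
    (h : P.obj a b ◁ unitinc b ≫ inc P unit a b b ≫ f =
      P.obj a b ◁ unitinc b ≫ inc P unit a b b ≫ g) : f = g :=
  tensor_ext fun c => left_hom_ext fun ⟨⟨hc⟩⟩ => by subst hc; exact h

lemma inc_whiskL (P : VQuiv V S) {Q Q' : VQuiv V S} (g : Q ⟶ Q') (a c b : S) :
    inc P Q a c b ≫ (whiskL P g).app a b = P.obj a c ◁ g.app c b ≫ inc P Q' a c b := by
  simp [whiskL]

lemma inc_whiskR {P P' : VQuiv V S} (f : P ⟶ P') (Q : VQuiv V S) (a c b : S) :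
    inc P Q a c b ≫ (whiskR f Q).app a b = f.app a c ▷ Q.obj c b ≫ inc P' Q a c b := by
  simp [whiskR]

lemma inc_homTensor {P P' Q Q' : VQuiv V S} (f : P ⟶ P') (g : Q ⟶ Q') (a c b : S) :
    inc P Q a c b ≫ (homTensor f g).app a b = (f.app a c ⊗ₘ g.app c b) ≫ inc P' Q' a c b := by
  simp [homTensor]

instance : MonoidalCategoryStruct (VQuiv V S) where
  tensorObj := tensor
  whiskerLeft P _ _ g := whiskL P g
  whiskerRight f Q := whiskR f Q
  tensorHom := homTensor
  tensorUnit := unit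
  associator P Q R :=
    { hom := assocHom P Q R
      inv := assocInv P Q R
      hom_inv_id := by
        refine hom_ext fun a b => tensor3_ext fun c d => ?_
        rw [comp_app, reassoc_of% inc_assocHom, inc_assocInv]
        simp
      inv_hom_id := by
        refine hom_ext fun a b => tensor3_ext' fun c d => ?_
        rw [comp_app, reassoc_of% inc_assocInv, inc_assocHom]
        simp }
  leftUnitor P :=
    { hom := lamHom P
      inv := lamInv P
      hom_inv_id := by
        refine hom_ext fun a b => unit_tensor_ext ?_
        rw [comp_app, reassoc_of% unitinc_lamHom]
        simp [lamInv]
      inv_hom_id := by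
        refine hom_ext fun a b => ?_
        simp only [lamInv, comp_app, Category.assoc, unitinc_lamHom]
        simp }
  rightUnitor P :=
    { hom := rhoHom P
      inv := rhoInv P
      hom_inv_id := by
        refine hom_ext fun a b => tensor_unit_ext ?_
        rw [comp_app, reassoc_of% unitinc_rhoHom]
        simp [rhoInv]
      inv_hom_id := by
        refine hom_ext fun a b => ?_
        simp only [rhoInv, comp_app, Category.assoc, unitinc_rhoHom]
        simp }

/-- The inclusion of a summand of a tensor product of quivers. -/
def tinc (P Q : VQuiv V S) (a c b : S) : P.obj a c ⊗ Q.obj c b ⟶ (P ⊗ Q).obj a b := inc P Q a c b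

variable {P P' Q Q' R T : VQuiv V S} {a b c d : S} {Z : V}

@[simp] lemma tinc_whiskerLeft (P : VQuiv V S) {Q Q' : VQuiv V S} (g : Q ⟶ Q') (a c b : S) :
    tinc P Q a c b ≫ Hom.app (P ◁ g) a b = P.obj a c ◁ g.app c b ≫ tinc P Q' a c b :=
  inc_whiskL P g a c b

@[simp] lemma tinc_whiskerLeft_assoc (g : Q ⟶ Q') (a c b : S) (h : (P ⊗ Q').obj a b ⟶ Z) :
    tinc P Q a c b ≫ Hom.app (P ◁ g) a b ≫ h = P.obj a c ◁ g.app c b ≫ tinc P Q' a c b ≫ h := by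
  rw [reassoc_of% tinc_whiskerLeft]

@[simp] lemma tinc_whiskerRight (f : P ⟶ P') (Q : VQuiv V S) (a c b : S) :
    tinc P Q a c b ≫ Hom.app (f ▷ Q) a b = f.app a c ▷ Q.obj c b ≫ tinc P' Q a c b :=
  inc_whiskR f Q a c b

@[simp] lemma tinc_whiskerRight_assoc (f : P ⟶ P') (a c b : S) (h : (P' ⊗ Q).obj a b ⟶ Z) :
    tinc P Q a c b ≫ Hom.app (f ▷ Q) a b ≫ h = f.app a c ▷ Q.obj c b ≫ tinc P' Q a c b ≫ h := by
  rw [reassoc_of% tinc_whiskerRight]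

@[simp] lemma tinc_tensorHom (f : P ⟶ P') (g : Q ⟶ Q') (a c b : S) :
    tinc P Q a c b ≫ Hom.app (f ⊗ₘ g) a b = (f.app a c ⊗ₘ g.app c b) ≫ tinc P' Q' a c b :=
  inc_homTensor f g a c b

@[simp] lemma tinc_tensorHom_assoc (f : P ⟶ P') (g : Q ⟶ Q') (a c b : S)
    (h : (P' ⊗ Q').obj a b ⟶ Z) :
    tinc P Q a c b ≫ Hom.app (f ⊗ₘ g) a b ≫ h =
      (f.app a c ⊗ₘ g.app c b) ≫ tinc P' Q' a c b ≫ h := by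
  rw [reassoc_of% tinc_tensorHom]

@[simp] lemma tinc_associator (P Q R : VQuiv V S) (a c d b : S) :
    tinc P Q a c d ▷ R.obj d b ≫ tinc (P ⊗ Q) R a d b ≫ Hom.app (α_ P Q R).hom a b =
    (α_ (P.obj a c) (Q.obj c d) (R.obj d b)).hom ≫ P.obj a c ◁ tinc Q R c d b ≫
      tinc P (Q ⊗ R) a c b :=
  inc_assocHom P Q R a c d b

@[simp] lemma tinc_associator_assoc (P Q R : VQuiv V S) (a c d b : S)
    (h : (P ⊗ (Q ⊗ R)).obj a b ⟶ Z) :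
    tinc P Q a c d ▷ R.obj d b ≫ tinc (P ⊗ Q) R a d b ≫ Hom.app (α_ P Q R).hom a b ≫ h =
    (α_ (P.obj a c) (Q.obj c d) (R.obj d b)).hom ≫ P.obj a c ◁ tinc Q R c d b ≫
      tinc P (Q ⊗ R) a c b ≫ h := by
  rw [reassoc_of% tinc_associator]

/-- The canonical morphism from the unit of `V` to the unit quiver. -/
def oneInc (V : Type u) [Category.{v} V] [MonoidalCategory V] [SymmetricCategory V]
  [MonoidalClosed V] [HasColimits V] {S : Type v} (a : S) : 𝟙_ V ⟶ (𝟙_ (VQuiv V S)).obj a a := unitinc a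

@[simp] lemma oneInc_leftUnitor (P : VQuiv V S) (a b : S) :
    oneInc V a ▷ P.obj a b ≫ tinc (𝟙_ _) P a a b ≫ Hom.app (λ_ P).hom a b = (λ_ (P.obj a b)).hom :=
  unitinc_lamHom P a b

@[simp] lemma oneInc_rightUnitor (P : VQuiv V S) (a b : S) :
    P.obj a b ◁ oneInc V b ≫ tinc P (𝟙_ _) a b b ≫ Hom.app (ρ_ P).hom a b = (ρ_ (P.obj a b)).hom :=
  unitinc_rhoHom P a b

lemma tinc_ext {f g : (P ⊗ Q).obj a b ⟶ Z}
    (h : ∀ c, tinc P Q a c b ≫ f = tinc P Q a c b ≫ g) : f = g :=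
  tensor_ext h

instance : MonoidalCategory (VQuiv V S) where
  tensorHom_def f g := hom_ext fun a b => tinc_ext fun c => by
    simp [MonoidalCategory.tensorHom_def]
  id_tensorHom_id P Q := hom_ext fun a b => tinc_ext fun c => by simp
  tensorHom_comp_tensorHom f g h k := hom_ext fun a b => tinc_ext fun c => by simp
  whiskerLeft_id P Q := hom_ext fun a b => tinc_ext fun c => by simp
  id_whiskerRight P Q := hom_ext fun a b => tinc_ext fun c => by simp
  associator_naturality {P Q R P' Q' R'} f g h := hom_ext fun a b => tensor3_ext fun c d => by
    have e1 : tinc P Q a c d ▷ R.obj d b ≫ (Hom.app (f ⊗ₘ g) a d ⊗ₘ h.app d b) =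
        ((f.app a c ⊗ₘ g.app c d) ⊗ₘ h.app d b) ≫ tinc P' Q' a c d ▷ R'.obj d b := by
      rw [← tensorHom_id, ← tensorHom_id, tensorHom_comp_tensorHom, tensorHom_comp_tensorHom,
        tinc_tensorHom]
      simp
    have e2 : P.obj a c ◁ tinc Q R c d b ≫ (f.app a c ⊗ₘ Hom.app (g ⊗ₘ h) c b) =
        (f.app a c ⊗ₘ (g.app c d ⊗ₘ h.app d b)) ≫ P'.obj a c ◁ tinc Q' R' c d b := by
      rw [← id_tensorHom, ← id_tensorHom, tensorHom_comp_tensorHom, tensorHom_comp_tensorHom,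
        tinc_tensorHom]
      simp
    change tinc P Q a c d ▷ R.obj d b ≫ tinc (P ⊗ Q) R a d b ≫ Hom.app _ a b ≫ Hom.app _ a b =
      tinc P Q a c d ▷ R.obj d b ≫ tinc (P ⊗ Q) R a d b ≫ Hom.app _ a b ≫ Hom.app _ a b
    rw [tinc_tensorHom_assoc, reassoc_of% e1, tinc_associator, tinc_associator_assoc,
      tinc_tensorHom, reassoc_of% e2]
    simp
  leftUnitor_naturality {P P'} f := hom_ext fun a b => unit_tensor_ext (by
    change oneInc V a ▷ P.obj a b ≫ tinc _ P a a b ≫ Hom.app _ a b ≫ Hom.app _ a b =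
      oneInc V a ▷ P.obj a b ≫ tinc _ P a a b ≫ Hom.app _ a b ≫ Hom.app _ a b
    rw [tinc_whiskerLeft_assoc, ← whisker_exchange_assoc, oneInc_leftUnitor,
      reassoc_of% oneInc_leftUnitor]
    simp)
  rightUnitor_naturality {P P'} f := hom_ext fun a b => tensor_unit_ext (by
    change P.obj a b ◁ oneInc V b ≫ tinc P _ a b b ≫ Hom.app _ a b ≫ Hom.app _ a b =
      P.obj a b ◁ oneInc V b ≫ tinc P _ a b b ≫ Hom.app _ a b ≫ Hom.app _ a b
    rw [tinc_whiskerRight_assoc, whisker_exchange_assoc, oneInc_rightUnitor,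
      reassoc_of% oneInc_rightUnitor]
    simp)
  pentagon P Q R T := hom_ext fun a b => tensor4_ext fun c d e => by
    change tinc P Q a c d ▷ R.obj d e ▷ T.obj e b ≫ tinc (P ⊗ Q) R a d e ▷ T.obj e b ≫
        tinc ((P ⊗ Q) ⊗ R) T a e b ≫ Hom.app _ a b ≫ Hom.app _ a b ≫ Hom.app _ a b =
      tinc P Q a c d ▷ R.obj d e ▷ T.obj e b ≫ tinc (P ⊗ Q) R a d e ▷ T.obj e b ≫
        tinc ((P ⊗ Q) ⊗ R) T a e b ≫ Hom.app _ a b ≫ Hom.app _ a b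
    have e1 := congrArg (fun f => f ▷ T.obj e b) (tinc_associator P Q R a c d e)
    simp only [comp_whiskerRight] at e1
    have e2 := congrArg (fun f => P.obj a c ◁ f) (tinc_associator Q R T c d e b)
    simp only [MonoidalCategory.whiskerLeft_comp] at e2
    have e3 := tinc_associator P (Q ⊗ R) T a c e b
    have e4 := tinc_associator (P ⊗ Q) R T a d e b
    have e5 := tinc_associator P Q (R ⊗ T) a c d b
    rw [tinc_whiskerRight_assoc, reassoc_of% e1, reassoc_of% e3, tinc_whiskerLeft]
    rw [reassoc_of% e4]
    rw [associator_naturality_middle_assoc, reassoc_of% e2, associator_naturality_left_assoc,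
      ← whisker_exchange_assoc, e5, associator_naturality_right_assoc, pentagon_assoc]
  triangle P Q := hom_ext fun a b => tensor_ext fun d => by
    have hi : IsIso (Hom.app (ρ_ P).inv a d) :=
      inferInstanceAs (IsIso ((eval V a d).map (ρ_ P).inv))
    have e0 : Hom.app (ρ_ P).inv a d =
      (ρ_ (P.obj a d)).inv ≫ P.obj a d ◁ oneInc V d ≫ tinc P (𝟙_ _) a d d := rfl
    have e1 : Hom.app (ρ_ P).inv a d ≫ Hom.app (ρ_ P).hom a d = 𝟙 _ := by
      rw [← comp_app, Iso.inv_hom_id, id_app]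
    have e2 := congrArg (fun f => P.obj a d ◁ f) (oneInc_leftUnitor Q d b)
    simp only [MonoidalCategory.whiskerLeft_comp] at e2
    have e3 := tinc_associator P (𝟙_ _) Q a d d b
    refine (cancel_epi (Hom.app (ρ_ P).inv a d ▷ Q.obj d b)).1 ?_
    change _ ≫ tinc (P ⊗ 𝟙_ _) Q a d b ≫ Hom.app _ a b ≫ Hom.app _ a b =
      _ ≫ tinc (P ⊗ 𝟙_ _) Q a d b ≫ Hom.app _ a b
    rw [tinc_whiskerRight, ← comp_whiskerRight_assoc, e1, id_whiskerRight, Category.id_comp, e0,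
      comp_whiskerRight_assoc, comp_whiskerRight_assoc, reassoc_of% e3, tinc_whiskerLeft,
      associator_naturality_middle_assoc, reassoc_of% e2]
    simp

end Monoidal

end VQuiv

section Paths

variable {W : Type*} [Category* W] [MonoidalCategory W]

/-- For `L = [t₁, …, tₖ]`, the tensor product `A (t₁ - s) ⊗ A (t₂ - t₁) ⊗ … ⊗ A (tₖ - tₖ₋₁)`,
bracketed to the right and ending in the unit. -/
@[reducible] def pathTensor (A : ℕ → W) : ℕ → List ℕ → W
  | _, [] => 𝟙_ W
  | s, t :: L => A (t - s) ⊗ pathTensor A t L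

namespace FinInt

/-- The canonical identification `[t - s] + [u - t] → [u - s]` for `s ≤ t ≤ u`. -/
def glue (s t u : ℕ) : (⟨t - s⟩ ⊗ ⟨u - t⟩ : FinInt) ⟶ ⟨u - s⟩ :=
  homMk (fun i => min i (u - s)) (fun i j h _ => by omega) (by simp)
    (by simp only [tensor_len]; omega)

lemma ev_glue (s t u i : ℕ) : ev (glue s t u) i = min i (u - s) := by
  refine (ev_homMk _ _ _ _ _).trans ?_
  simp only [tensor_len]; omega

/-- The restriction `[t - s] → [f t - f s]` of `f` to the interval from `s` to `t`. -/
def res {m n : FinInt} (f : m ⟶ n) (s t r q : ℕ) (hs : ev f s = r) (ht : ev f t = q) :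
    (⟨t - s⟩ : FinInt) ⟶ ⟨q - r⟩ :=
  homMk (fun i => ev f (s + i) - r)
    (fun i j h _ => by have := ev_mono f (show s + i ≤ s + j by omega); omega)
    (by simp [hs])
    (by
      subst hs ht
      rcases le_total s t with h | h
      · simp [Nat.add_sub_cancel' h]
      · have := ev_mono f h
        simp only [Nat.sub_eq_zero_of_le h, Nat.sub_eq_zero_of_le this]; simp)

lemma ev_res {m n : FinInt} (f : m ⟶ n) (s t r q : ℕ) (hs : ev f s = r) (ht : ev f t = q)
    (i : ℕ) : ev (res f s t r q hs ht) i = ev f (s + min i (t - s)) - r :=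
  ev_homMk _ _ _ _ _

lemma toZero_unique' {n : FinInt} (f g : n ⟶ 𝟙_ FinInt) : f = g := hom_ext fun i _ => by
  have h1 := ev_le f i
  have h2 := ev_le g i
  simp only [unit_len] at *
  omega

/-- The opposite of the unique morphism `[n] → [0]`. -/
def toZero (n : ℕ) : 𝟙_ FinIntᵒᵖ ⟶ op ⟨n⟩ :=
  Quiver.Hom.op (homMk (m := ⟨n⟩) (n := 𝟙_ FinInt) (fun _ => 0) (fun _ _ _ _ => le_rfl) rfl rfl)

lemma ev_toZero (n i : ℕ) : ev (toZero n).unop i = 0 := rfl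

lemma toZero_unique {n : FinIntᵒᵖ} (f g : 𝟙_ FinIntᵒᵖ ⟶ n) : f = g :=
  Quiver.Hom.unop_inj (toZero_unique' f.unop g.unop)

/-- `glue` in the opposite category. -/
def glueOp (s t u : ℕ) : (op ⟨u - s⟩ : FinIntᵒᵖ) ⟶ op ⟨t - s⟩ ⊗ op ⟨u - t⟩ := (glue s t u).op

end FinInt

open FinInt

variable (X : FinIntᵒᵖ ⥤ W)

/-- The object `X_n`. -/
abbrev simplices (n : ℕ) : W := X.obj (op ⟨n⟩)

variable [X.OplaxMonoidal]

/-- The comultiplication `X_{u - s} → X_{t - s} ⊗ X_{u - t}` for `s ≤ t ≤ u`. -/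
def split (s t u : ℕ) : simplices X (u - s) ⟶ simplices X (t - s) ⊗ simplices X (u - t) :=
  X.map (glueOp s t u) ≫ Functor.OplaxMonoidal.δ X (op ⟨t - s⟩) (op ⟨u - t⟩)

lemma split_coassoc {s t u w : ℕ} (h1 : s ≤ t) (h2 : t ≤ u) (h3 : u ≤ w) :
    split X s t w ≫ simplices X (t - s) ◁ split X t u w =
      split X s u w ≫ split X s t u ▷ simplices X (w - u) ≫ (α_ _ _ _).hom := by
  have e : glueOp s t w ≫ op ⟨t - s⟩ ◁ glueOp t u w =
      glueOp s u w ≫ glueOp s t u ▷ op ⟨w - u⟩ ≫ (α_ _ _ _).hom := by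
    refine Quiver.Hom.unop_inj (hom_ext fun i hi => ?_)
    change ev ((⟨t - s⟩ ◁ glue t u w) ≫ glue s t w) i =
      ev (((α_ _ _ _).inv ≫ glue s t u ▷ ⟨w - u⟩) ≫ glue s u w) i
    replace hi : i ≤ (t - s) + ((u - t) + (w - u)) := hi
    simp only [ev_comp, ev_whiskerLeft, ev_whiskerRight, ev_glue, ev_associator_inv, tensor_len] at *
    split_ifs <;> omega
  simp only [split, MonoidalCategory.whiskerLeft_comp, comp_whiskerRight, Category.assoc,
    Functor.OplaxMonoidal.δ_natural_left_assoc, Functor.OplaxMonoidal.δ_natural_right_assoc,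
    Functor.OplaxMonoidal.associativity]
  simp only [← X.map_comp_assoc, e]

lemma split_nat {m n : FinInt} (f : m ⟶ n) {s t u r q v : ℕ} (h1 : s ≤ t) (h2 : t ≤ u)
    (hs : ev f s = r) (ht : ev f t = q) (hu : ev f u = v) :
    split X r q v ≫ (X.map (res f s t r q hs ht).op ⊗ₘ X.map (res f t u q v ht hu).op) =
      X.map (res f s u r v hs hu).op ≫ split X s t u := by
  have e : glueOp r q v ≫ ((res f s t r q hs ht).op ⊗ₘ (res f t u q v ht hu).op) =
      (res f s u r v hs hu).op ≫ glueOp s t u := by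
    refine Quiver.Hom.unop_inj (hom_ext fun i hi => ?_)
    change ev ((res f s t r q hs ht ⊗ₘ res f t u q v ht hu) ≫ glue r q v) i =
      ev (glue s t u ≫ res f s u r v hs hu) i
    replace hi : i ≤ (t - s) + (u - t) := hi
    have e1 := ev_mono f (show s ≤ s + i by omega)
    have e2 := ev_mono f h1
    have e3 := ev_mono f h2
    simp only [ev_comp, ev_tensorHom, ev_glue, ev_res] at *
    have e4 : i ≤ t - s → min i (t - s) = i := fun h => by omega
    have e5 : ¬ i ≤ t - s → t + min (i - (t - s)) (u - t) = s + i := fun h => by omega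
    have e6 : min (min i (u - s)) (u - s) = i := by omega
    have e7 := ev_mono f (show s + i ≤ u by omega)
    have e8 : ¬ i ≤ t - s → ev f t ≤ ev f (s + i) := fun h => ev_mono f (by omega)
    rw [e6]
    split_ifs with h
    · rw [e4 h]; omega
    · rw [e5 h]; have := e8 h; omega
  simp only [split, Category.assoc, Functor.OplaxMonoidal.δ_natural, ← X.map_comp_assoc, e]

variable [IsIso (Functor.OplaxMonoidal.η X)]

/-- The totally degenerate morphism `I ≅ X_0 → X_n`. -/
def unitMap (n : ℕ) : 𝟙_ W ⟶ simplices X n :=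
  inv (Functor.OplaxMonoidal.η X) ≫ X.map (toZero n)

lemma unitMap_map {m n : ℕ} (f : (⟨m⟩ : FinInt) ⟶ ⟨n⟩) :
    unitMap X n ≫ X.map f.op = unitMap X m := by
  rw [unitMap, unitMap, Category.assoc, ← X.map_comp, toZero_unique (toZero n ≫ f.op) (toZero m)]

lemma split_left (s u : ℕ) :
    split X s s u = (λ_ _).inv ≫ unitMap X (s - s) ▷ simplices X (u - s) := by
  have e : glueOp s s u = (λ_ _).inv ≫ toZero (s - s) ▷ op ⟨u - s⟩ := by
    refine Quiver.Hom.unop_inj (hom_ext fun i hi => ?_)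
    change ev (glue s s u) i = ev ((toZero (s - s)).unop ▷ ⟨u - s⟩ ≫ (λ_ _).hom) i
    replace hi : i ≤ (s - s) + (u - s) := hi
    simp only [ev_comp, ev_whiskerRight, ev_glue, ev_leftUnitor_hom, ev_toZero]
    have h0 : (unop (𝟙_ FinIntᵒᵖ)).len = 0 := rfl
    split_ifs <;> omega
  rw [Functor.OplaxMonoidal.left_unitality]
  simp only [Category.assoc, ← comp_whiskerRight, unitMap, IsIso.hom_inv_id_assoc,
    Functor.OplaxMonoidal.δ_natural_left, split, e, X.map_comp]

lemma split_right (s u : ℕ) :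
    split X s u u = (ρ_ _).inv ≫ simplices X (u - s) ◁ unitMap X (u - u) := by
  have e : glueOp s u u = (ρ_ _).inv ≫ op ⟨u - s⟩ ◁ toZero (u - u) := by
    refine Quiver.Hom.unop_inj (hom_ext fun i hi => ?_)
    change ev (glue s u u) i = ev (⟨u - s⟩ ◁ (toZero (u - u)).unop ≫ (ρ_ _).hom) i
    replace hi : i ≤ (u - s) + (u - u) := hi
    simp only [ev_comp, ev_whiskerLeft, ev_glue, ev_rightUnitor_hom, ev_toZero]
    split_ifs <;> omega
  rw [Functor.OplaxMonoidal.right_unitality]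
  simp only [Category.assoc, ← MonoidalCategory.whiskerLeft_comp, unitMap,
    IsIso.hom_inv_id_assoc, Functor.OplaxMonoidal.δ_natural_right, split, e, X.map_comp]

lemma unitMap_split (s t u : ℕ) :
    unitMap X (u - s) ≫ split X s t u =
      (λ_ _).inv ≫ (unitMap X (t - s) ⊗ₘ unitMap X (u - t)) := by
  have e : toZero (u - s) ≫ glueOp s t u = (λ_ _).inv ≫ (toZero (t - s) ⊗ₘ toZero (u - t)) := by
    refine Quiver.Hom.unop_inj (toZero_unique' _ _)
  have e1 : Functor.OplaxMonoidal.η X ≫ (λ_ _).inv =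
      X.map (λ_ _).inv ≫ Functor.OplaxMonoidal.δ X _ _ ≫
        (Functor.OplaxMonoidal.η X ⊗ₘ Functor.OplaxMonoidal.η X) := by
    rw [leftUnitor_inv_naturality, Functor.OplaxMonoidal.left_unitality,
      MonoidalCategory.tensorHom_def]
    simp only [Category.assoc]
  rw [← cancel_epi (Functor.OplaxMonoidal.η X), unitMap, unitMap, unitMap,
    ← tensorHom_comp_tensorHom, reassoc_of% e1]
  simp only [split, Category.assoc, IsIso.hom_inv_id_assoc, tensorHom_comp_tensorHom_assoc,
    IsIso.hom_inv_id, id_tensorHom_id, Category.id_comp, Functor.OplaxMonoidal.δ_natural,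
    ← X.map_comp_assoc, e]

/-- The inert part: if `M` is obtained from the increasing list `L` by omitting entries, the
morphism obtained by inserting the missing entries through the comultiplication. Entries that
equal their predecessor are inserted through `I ≅ X_0`. -/
def refine : (s : ℕ) → (M L : List ℕ) → M.Sublist L →
    (pathTensor (simplices X) s M ⟶ pathTensor (simplices X) s L)
  | _, [], [], _ => 𝟙 _
  | _, _ :: _, [], h => absurd h (by simp)
  | s, [], t :: L, _ => (λ_ (𝟙_ W)).inv ≫ (unitMap X (t - s) ⊗ₘ refine t [] L (by simp))
  | s, u :: M, t :: L, h =>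
    if hut : u = t then
      simplices X (u - s) ◁ refine u M L (by subst hut; simpa using h) ≫ eqToHom (by rw [hut])
    else
      split X s t u ▷ pathTensor (simplices X) u M ≫ (α_ _ _ _).hom ≫
        simplices X (t - s) ◁ refine t (u :: M) L (by
          rcases List.sublist_cons_iff.1 h with h | ⟨_, h, _⟩
          · exact h
          · exact absurd (List.cons.inj h).1 hut)

lemma sublist_of_ne {t u : ℕ} {M L : List ℕ} (h : (u :: M).Sublist (t :: L)) (hut : u ≠ t) :
    (u :: M).Sublist L := by
  rcases List.sublist_cons_iff.1 h with h | ⟨_, h, _⟩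
  · exact h
  · exact absurd (List.cons.inj h).1 hut

lemma refine_keep (s t : ℕ) {M L : List ℕ} (h : (t :: M).Sublist (t :: L))
    (h' : M.Sublist L) :
    refine X s (t :: M) (t :: L) h = simplices X (t - s) ◁ refine X t M L h' := by
  simp only [refine, dite_true]
  exact Category.comp_id _

lemma refine_split (s : ℕ) {t u : ℕ} {M L : List ℕ} (h : (u :: M).Sublist (t :: L))
    (h' : (u :: M).Sublist L) (hut : u ≠ t) :
    refine X s (u :: M) (t :: L) h = split X s t u ▷ pathTensor (simplices X) u M ≫
      (α_ _ _ _).hom ≫ simplices X (t - s) ◁ refine X t (u :: M) L h' := by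
  simp only [refine, hut, dite_false]

lemma refine_nil (s t : ℕ) (L : List ℕ) (h : [].Sublist (t :: L)) :
    refine X s [] (t :: L) h =
      (λ_ (𝟙_ W)).inv ≫ (unitMap X (t - s) ⊗ₘ refine X t [] L (by simp)) := by
  simp only [refine]

lemma refine_self (s : ℕ) (L : List ℕ) (h : L.Sublist L) : refine X s L L h = 𝟙 _ := by
  induction L generalizing s with
  | nil => simp [refine]
  | cons t L ih => rw [refine_keep X s t h (List.Sublist.refl L), ih,
    MonoidalCategory.whiskerLeft_id]

/-- Insertion of a trivial bead. -/
def ins (s : ℕ) (M : List ℕ) :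
    pathTensor (simplices X) s M ⟶ pathTensor (simplices X) s (s :: M) :=
  (λ_ _).inv ≫ unitMap X (s - s) ▷ pathTensor (simplices X) s M

lemma ins_nat (s : ℕ) {M L : List ℕ}
    (r : pathTensor (simplices X) s M ⟶ pathTensor (simplices X) s L) :
    r ≫ ins X s L = ins X s M ≫ simplices X (s - s) ◁ r := by
  rw [ins, ins, leftUnitor_inv_naturality_assoc, Category.assoc, whisker_exchange]

instance (s : ℕ) : IsIso (unitMap X (s - s)) := by
  have : IsIso (toZero (s - s)) := by
    rw [toZero_unique (toZero (s - s)) (castIso (m := ⟨s - s⟩) (n := 𝟙_ FinInt)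
      (Nat.sub_self s)).hom.op]
    infer_instance
  unfold unitMap
  infer_instance

lemma ins_cons_self (s : ℕ) (M : List ℕ) :
    ins X s (s :: M) = simplices X (s - s) ◁ ins X s M := by
  refine (cancel_epi (unitMap X (s - s) ▷ pathTensor (simplices X) s M)).1 ?_
  change _ ≫ (λ_ (simplices X (s - s) ⊗ pathTensor (simplices X) s M)).inv ≫
    unitMap X (s - s) ▷ (simplices X (s - s) ⊗ pathTensor (simplices X) s M) = _ ≫ _ ◁ ((λ_ _).inv ≫
      unitMap X (s - s) ▷ pathTensor (simplices X) s M)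
  rw [leftUnitor_inv_naturality_assoc, whisker_exchange, MonoidalCategory.whiskerLeft_comp,
    ← whisker_exchange_assoc]
  congr 1
  monoidal

lemma ins_cons (s u : ℕ) (M : List ℕ) :
    ins X s (u :: M) = split X s s u ▷ pathTensor (simplices X) u M ≫ (α_ _ _ _).hom := by
  rw [split_left]
  change (λ_ (simplices X (u - s) ⊗ pathTensor (simplices X) u M)).inv ≫
    unitMap X (s - s) ▷ (simplices X (u - s) ⊗ pathTensor (simplices X) u M) = _
  simp [-Functor.OplaxMonoidal.left_unitality]

lemma ins_cons_right (s u : ℕ) (M : List ℕ) :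
    split X s u u ▷ pathTensor (simplices X) u M ≫ (α_ _ _ _).hom =
      simplices X (u - s) ◁ ins X u M := by
  rw [split_right, ins]
  simp [-Functor.OplaxMonoidal.right_unitality]

lemma ins_refine (s : ℕ) (L : List ℕ) (hL : (s :: L).Pairwise (· ≤ ·)) (M : List ℕ)
    (h : (s :: M).Sublist L) (h' : M.Sublist L) :
    ins X s M ≫ refine X s (s :: M) L h = refine X s M L h' := by
  induction L generalizing M with
  | nil => simp at h
  | cons t L ih =>
    have hL' := hL
    simp only [List.pairwise_cons, List.mem_cons, forall_eq_or_imp] at hL'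
    obtain ⟨⟨hst, hsL⟩, htL, hL2⟩ := hL'
    have hts : s = t := by
      by_contra hne
      rcases List.sublist_cons_iff.1 h with h | ⟨_, h, _⟩
      · have := htL s (h.subset (by simp))
        omega
      · exact hne (List.cons.inj h).1
    subst hts
    have h1 : M.Sublist L := by simpa using h
    rw [refine_keep X s s h h1]
    cases M with
    | nil =>
      rw [refine_nil, ins, MonoidalCategory.tensorHom_def, Category.assoc]
    | cons u M =>
      by_cases hu : u = s
      · subst hu
        have h2 : M.Sublist L := by simpa using h'
        rw [refine_keep X u u h' h2, ins_cons_self, ← MonoidalCategory.whiskerLeft_comp,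
          ih (by simpa using ⟨hsL, hL2⟩) M h1 h2]
      · rw [refine_split X s h' h1 hu, ins_cons, Category.assoc]

lemma refine_comp (s : ℕ) (N M L : List ℕ) (hL : (s :: L).Pairwise (· ≤ ·))
    (hN : N.Sublist M) (hM : M.Sublist L) (h : N.Sublist L) :
    refine X s N M hN ≫ refine X s M L hM = refine X s N L h := by
  induction L generalizing s N M with
  | nil =>
    obtain rfl : M = [] := by simpa using hM
    obtain rfl : N = [] := by simpa using hN
    rw [refine_self, Category.id_comp]
  | cons t L ih =>
    have hL' := hL
    simp only [List.pairwise_cons, List.mem_cons, forall_eq_or_imp] at hL'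
    obtain ⟨⟨hst, hsL⟩, htL, hL2⟩ := hL'
    have hL3 : (t :: L).Pairwise (· ≤ ·) := by simpa using ⟨htL, hL2⟩
    cases M with
    | nil =>
      obtain rfl : N = [] := by simpa using hN
      rw [refine_self, Category.id_comp]
    | cons u M =>
      by_cases hu : u = t
      · subst hu
        have hM1 : M.Sublist L := by simpa using hM
        rw [refine_keep X s u hM hM1]
        cases N with
        | nil =>
          rw [refine_nil, refine_nil, ← ih u [] M hL3 (by simp) hM1 (by simp)]
          simp [MonoidalCategory.tensorHom_def]
        | cons w N =>
          by_cases hw : w = u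
          · subst hw
            have hN1 : N.Sublist M := by simpa using hN
            have h1 : N.Sublist L := by simpa using h
            rw [refine_keep X s w hN hN1, refine_keep X s w h h1,
              ← MonoidalCategory.whiskerLeft_comp, ih w N M hL3 hN1 hM1 h1]
          · have hN1 := sublist_of_ne hN hw
            rw [refine_split X s hN hN1 hw, refine_split X s h (hN1.trans hM1) hw,
              ← ih u (w :: N) M hL3 hN1 hM1 (hN1.trans hM1)]
            simp only [MonoidalCategory.whiskerLeft_comp, Category.assoc]
      · have hM1 := sublist_of_ne hM hu
        have htu := htL u (hM1.subset (by simp))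
        rw [refine_split X s hM hM1 hu]
        cases N with
        | nil =>
          rw [refine_nil, refine_nil, ← ih t [] (u :: M) hL3 (by simp) hM1 (by simp), refine_nil,
            MonoidalCategory.tensorHom_def]
          have e := unitMap_split X s t u
          simp only [Category.assoc]
          rw [whisker_exchange_assoc, ← comp_whiskerRight_assoc, e]
          simp only [MonoidalCategory.tensorHom_def, Category.assoc, comp_whiskerRight,
            MonoidalCategory.whiskerLeft_comp]
          monoidal
        | cons w N =>
          by_cases hw : w = u
          · subst hw
            have hN1 : N.Sublist M := by simpa using hN
            rw [refine_keep X s w hN hN1, refine_split X s h ((hN.trans hM1)) hu,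
              ← ih t (w :: N) (w :: M) hL3 hN hM1 (hN.trans hM1), refine_keep X t w hN hN1]
            simp only [MonoidalCategory.whiskerLeft_comp, whisker_exchange_assoc,
              tensor_whiskerLeft, Category.assoc, Iso.inv_hom_id_assoc]
          · have hN1 := sublist_of_ne hN hw
            have hMs : (u :: M).Pairwise (· ≤ ·) := hL2.sublist hM1
            have huw : u ≤ w := (List.pairwise_cons.1 hMs).1 w (hN1.subset (by simp))
            have hwt : w ≠ t := by omega
            rw [refine_split X s hN hN1 hw, refine_split X s h (hN.trans hM1) hwt,
              ← ih t (w :: N) (u :: M) hL3 hN hM1 (hN.trans hM1), refine_split X t hN hN1 hw]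
            have e := congrArg (fun f => f ▷ pathTensor (simplices X) w N)
              (split_coassoc X hst htu huw)
            simp only [comp_whiskerRight] at e
            simp only [MonoidalCategory.whiskerLeft_comp, Category.assoc]
            rw [whisker_exchange_assoc, ← associator_naturality_middle_assoc, reassoc_of% e]
            monoidal

variable {X} in
/-- The active part: the tensor product of the morphisms induced by the restrictions of `f` to the
intervals between consecutive entries of `L`. -/
def active {m n : FinInt} (f : m ⟶ n) : (r s : ℕ) → ev f s = r → (L' L : List ℕ) →
    L.map (ev f) = L' → (pathTensor (simplices X) r L' ⟶ pathTensor (simplices X) s L)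
  | _, _, _, [], [], _ => 𝟙 _
  | r, s, h, t' :: L', t :: L, hL =>
    X.map (res f s t r t' h (List.cons.inj hL).1).op ⊗ₘ
      active f t' t (List.cons.inj hL).1 L' L (List.cons.inj hL).2
  | _, _, _, [], _ :: _, h => absurd h (by simp)
  | _, _, _, _ :: _, [], h => absurd h (by simp)

lemma active_id {m : FinInt} (s : ℕ) (h : ev (𝟙 m) s = s) (L : List ℕ)
    (hs : (s :: L).Pairwise (· ≤ ·)) (hL : L.map (ev (𝟙 m)) = L) :
    active (X := X) (𝟙 m) s s h L L hL = 𝟙 _ := by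
  induction L generalizing s with
  | nil => simp [active]
  | cons t L ih =>
    have e : res (𝟙 m) s t s t h (List.cons.inj hL).1 = 𝟙 _ := hom_ext fun i hi => by
      replace hi : i ≤ t - s := hi
      have h1 := (List.cons.inj hL).1
      have h2 := (List.pairwise_cons.1 hs).1 t (by simp)
      rw [ev_id] at h1
      rw [ev_res, ev_id, ev_id]
      change min (s + min i (t - s)) m.len - s = min i (t - s)
      omega
    rw [active, ih t _ (List.pairwise_cons.1 hs).2 _, e]
    simp

lemma active_comp {l m n : FinInt} (f : l ⟶ m) (g : m ⟶ n) (q r s : ℕ) (hf : ev f s = r)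
    (hg : ev g r = q) (h : ev (f ≫ g) s = q) (L'' L' L : List ℕ)
    (hs : (s :: L).Pairwise (· ≤ ·)) (hL : L.map (ev f) = L') (hL' : L'.map (ev g) = L'')
    (hL'' : L.map (ev (f ≫ g)) = L'') :
    active (X := X) g q r hg L'' L' hL' ≫ active (X := X) f r s hf L' L hL =
      active (X := X) (f ≫ g) q s h L'' L hL'' := by
  induction L generalizing q r s L' L'' with
  | nil =>
    obtain rfl : L' = [] := by simpa using hL.symm
    obtain rfl : L'' = [] := by simpa using hL'.symm
    simp [active]
  | cons t L ih =>
    cases L' with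
    | nil => simp at hL
    | cons t' L' =>
      cases L'' with
      | nil => simp at hL'
      | cons t'' L'' =>
        obtain ⟨ht', hL1⟩ := List.cons.inj hL
        obtain ⟨ht'', hL1'⟩ := List.cons.inj hL'
        obtain ⟨h5, hL1''⟩ := List.cons.inj hL''
        have h1 := (List.pairwise_cons.1 hs).1 t (by simp)
        have e : res f s t r t' hf ht' ≫ res g r t' q t'' hg ht'' =
            res (f ≫ g) s t q t'' h h5 := hom_ext fun i hi => by
          replace hi : i ≤ t - s := hi
          have h3 := ev_mono f (show s ≤ s + i by omega)
          have h4 := ev_mono f (show s + i ≤ t by omega)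
          simp only [ev_comp, ev_res, min_eq_left hi]
          rw [show r + min (ev f (s + i) - r) (t' - r) = ev f (s + i) by omega]
        rw [active, active, active, tensorHom_comp_tensorHom, ← X.map_comp, ← op_comp, e,
          ih _ _ _ _ _ h5 _ _ (List.pairwise_cons.1 hs).2 hL1 hL1' hL1'']

lemma active_refine {m n : FinInt} (f : m ⟶ n) (r s : ℕ) (h : ev f s = r)
    (M' M L' L : List ℕ) (hs : (s :: L).Pairwise (· ≤ ·)) (hs' : (r :: L').Pairwise (· ≤ ·))
    (hM : M.map (ev f) = M')
    (hL : L.map (ev f) = L') (hML : M.Sublist L) (hML' : M'.Sublist L') :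
    active (X := X) f r s h M' M hM ≫ refine X s M L hML =
      refine X r M' L' hML' ≫ active (X := X) f r s h L' L hL := by
  induction L generalizing r s M M' L' with
  | nil =>
    obtain rfl : M = [] := by simpa using hML
    obtain rfl : L' = [] := by simpa using hL.symm
    obtain rfl : M' = [] := by simpa using hML'
    simp [active, refine]
  | cons t L ih =>
    cases L' with
    | nil => simp at hL
    | cons t' L' =>
      obtain ⟨ht', hL1⟩ := List.cons.inj hL
      have hs2 := (List.pairwise_cons.1 hs).2
      have hs2' := (List.pairwise_cons.1 hs').2
      have hst := (List.pairwise_cons.1 hs).1 t (by simp)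
      cases M with
      | nil =>
        obtain rfl : M' = [] := by simpa using hM.symm
        have e := ih t' t ht' [] [] L' hs2 hs2' rfl hL1 (by simp) (by simp)
        simp only [active, Category.id_comp] at e
        rw [refine_nil, refine_nil, active, active, e, Category.id_comp, Category.assoc,
          tensorHom_comp_tensorHom, unitMap_map]
      | cons u M =>
        cases M' with
        | nil => simp at hM
        | cons u' M' =>
          obtain ⟨hu', hM1'⟩ := List.cons.inj hM
          by_cases hu : u = t
          · subst hu
            obtain rfl : u' = t' := by omega
            have hM1 : M.Sublist L := by simpa using hML
            have hM2 : M'.Sublist L' := by simpa using hML'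
            rw [refine_keep X s u hML hM1, refine_keep X r u' hML' hM2, active, active,
              ← id_tensorHom, ← id_tensorHom, tensorHom_comp_tensorHom, tensorHom_comp_tensorHom,
              ih _ _ ht' _ _ _ hs2 hs2' hM1' hL1 hM1 hM2, Category.comp_id, Category.id_comp]
          · have hM1 := sublist_of_ne hML hu
            have htu := (List.pairwise_cons.1 hs2).1 u (hM1.subset (by simp))
            have hM2 : (u' :: M').Sublist L' := by
              rw [← hM, ← hL1]
              exact hM1.map _
            have e1 : refine X r (u' :: M') (t' :: L') hML' =
                split X r t' u' ▷ pathTensor (simplices X) u' M' ≫ (α_ _ _ _).hom ≫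
                  simplices X (t' - r) ◁ refine X t' (u' :: M') L' hM2 := by
              by_cases hut' : u' = t'
              · subst hut'
                have hM3 : M'.Sublist L' := by simpa using hML'
                rw [refine_keep X r u' hML' hM3, ← ins_refine X u' L' hs2' M' hM2 hM3,
                  MonoidalCategory.whiskerLeft_comp, ← ins_cons_right, Category.assoc]
              · rw [refine_split X r hML' hM2 hut']
            have e2 := ih t' t ht' (u' :: M') (u :: M) L' hs2 hs2' hM hL1 hM1 hM2
            have e3 := split_nat X f hst htu h ht' hu'
            rw [refine_split X s hML hM1 hu, e1, active, active]
            rw [active] at e2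
            simp only [Category.assoc]
            rw [← id_tensorHom (simplices X (t' - r)), tensorHom_comp_tensorHom, Category.id_comp,
              ← e2]
            rw [← Category.comp_id (X.map (res f s t r t' h ht').op), ← tensorHom_comp_tensorHom,
              ← associator_naturality_assoc, ← tensorHom_id, ← tensorHom_id,
              tensorHom_comp_tensorHom_assoc, tensorHom_comp_tensorHom_assoc, e3, id_tensorHom,
              Category.comp_id, Category.id_comp]

end Paths

/-- A necklace, given by its last vertex `p` and its set of joints `T`, where
`{0, p} ⊆ T ⊆ {0, …, p}`. Its beads are the intervals between consecutive joints. -/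
@[ext]
structure Necklace where
  last : ℕ
  joints : Finset ℕ
  zero_mem : 0 ∈ joints
  last_mem : last ∈ joints
  le_last : ∀ t ∈ joints, t ≤ last

namespace Necklace

/-- The interval of vertices of a necklace. -/
abbrev vertices (T : Necklace) : FinInt := ⟨T.last⟩

/-- A necklace map `(T, p) → (U, q)` is an endpoint preserving order morphism `f : [p] → [q]` with
`U ⊆ f(T)`. -/
@[ext]
structure Hom (T U : Necklace) where
  toHom : T.vertices ⟶ U.vertices
  joints_subset : U.joints ⊆ T.joints.image (FinInt.ev toHom)

lemma image_id (T : Necklace) (A : Finset ℕ) (hA : ∀ t ∈ A, t ≤ T.last) :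
    A.image (FinInt.ev (𝟙 T.vertices)) = A := by
  ext x
  simp only [Finset.mem_image, FinInt.ev_id]
  constructor
  · rintro ⟨y, hy, rfl⟩
    rwa [min_eq_left (hA y hy)]
  · exact fun hx => ⟨x, hx, min_eq_left (hA x hx)⟩

lemma image_comp {T U R : FinInt} (f : T ⟶ U) (g : U ⟶ R) (A : Finset ℕ) :
    A.image (FinInt.ev (f ≫ g)) = (A.image (FinInt.ev f)).image (FinInt.ev g) := by
  rw [Finset.image_image]
  congr 1
  funext x
  exact FinInt.ev_comp f g x

instance : Category Necklace where
  Hom := Hom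
  id T := ⟨𝟙 _, by rw [image_id _ _ T.le_last]⟩
  comp f g := ⟨f.toHom ≫ g.toHom, by
    rw [image_comp]
    exact g.joints_subset.trans (Finset.image_subset_image f.joints_subset)⟩

lemma id_toHom (T : Necklace) : Hom.toHom (𝟙 T) = 𝟙 _ := rfl
lemma comp_toHom {T U R : Necklace} (f : T ⟶ U) (g : U ⟶ R) :
    Hom.toHom (f ≫ g) = f.toHom ≫ g.toHom := rfl

lemma hom_ext {T U : Necklace} {f g : T ⟶ U} (h : f.toHom = g.toHom) : f = g := Hom.ext h

/-- The joints of a necklace other than `0`, in increasing order. -/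
def jointList (T : Necklace) : List ℕ := (T.joints.erase 0).sort (· ≤ ·)

lemma mem_jointList {T : Necklace} {t : ℕ} : t ∈ T.jointList ↔ t ≠ 0 ∧ t ∈ T.joints := by
  simp [jointList]

lemma pairwise_jointList (T : Necklace) : (0 :: T.jointList).Pairwise (· ≤ ·) := by
  refine List.pairwise_cons.2 ⟨fun _ _ => Nat.zero_le _, ?_⟩
  exact Finset.pairwise_sort _ _

lemma pairwise_map {m n : FinInt} (f : m ⟶ n) {L : List ℕ} (hL : (0 :: L).Pairwise (· ≤ ·)) :
    (0 :: L.map (FinInt.ev f)).Pairwise (· ≤ ·) := by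
  refine List.pairwise_cons.2 ⟨fun _ _ => Nat.zero_le _, ?_⟩
  exact List.Pairwise.map _ (fun a b h => FinInt.ev_mono f h) (List.pairwise_cons.1 hL).2

lemma sublist_map {T U : Necklace} (f : T ⟶ U) :
    U.jointList.Sublist (T.jointList.map (FinInt.ev f.toHom)) := by
  refine List.sublist_of_subperm_of_pairwise (r := (· ≤ ·)) ?_
    (List.pairwise_cons.1 U.pairwise_jointList).2
    (List.pairwise_cons.1 (pairwise_map f.toHom T.pairwise_jointList)).2
  refine List.Nodup.subperm (Finset.sort_nodup _ _) fun u hu => ?_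
  obtain ⟨hu0, hu⟩ := mem_jointList.1 hu
  obtain ⟨t, ht, rfl⟩ := Finset.mem_image.1 (f.joints_subset hu)
  refine List.mem_map.2 ⟨t, mem_jointList.2 ⟨?_, ht⟩, rfl⟩
  rintro rfl
  exact hu0 (FinInt.ev_zero _)

lemma map_id_jointList (T : Necklace) :
    T.jointList.map (FinInt.ev (𝟙 T.vertices)) = T.jointList := by
  conv_rhs => rw [← List.map_id T.jointList]
  refine List.map_congr_left fun t ht => ?_
  rw [FinInt.ev_id, min_eq_left (T.le_last t (mem_jointList.1 ht).2)]
  rfl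

section

variable {W : Type*} [Category* W] [MonoidalCategory W]

/-- For a necklace `T = {0 = t₀ < t₁ < … < tₖ}` and objects `A n`, the tensor product
`A (t₁ - t₀) ⊗ A (t₂ - t₁) ⊗ … ⊗ A (tₖ - tₖ₋₁)`, which is the unit if `k = 0`. -/
abbrev tensorBeads (A : ℕ → W) (T : Necklace) : W := pathTensor A 0 T.jointList

variable (X : FinIntᵒᵖ ⥤ W) [X.OplaxMonoidal] [IsIso (Functor.OplaxMonoidal.η X)]

lemma refine_active_congr {m n : FinInt} (f : m ⟶ n) (h0 : FinInt.ev f 0 = 0) {M L L₁ L₂ : List ℕ}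
    (e : L₁ = L₂) (h₂ : M.Sublist L₂) (hL₂ : L.map (FinInt.ev f) = L₂)
    {h₁ : M.Sublist L₁} {hL₁ : L.map (FinInt.ev f) = L₁} :
    refine X 0 M L₁ h₁ ≫ active (X := X) f 0 0 h0 L₁ L hL₁ =
      refine X 0 M L₂ h₂ ≫ active (X := X) f 0 0 h0 L₂ L hL₂ := by
  subst e
  rfl

/-- The functor `T ↦ X_T` on necklaces. For a necklace map `f : T → U`, the morphism `X_U → X_T` is
the composite of the inert part `X_U → X_{f(T)}`, given by comultiplications, with the active part
`X_{f(T)} → X_T`, given by the restrictions of `f` to the beads of `T`. -/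
def necklaceFunctor : Necklaceᵒᵖ ⥤ W where
  obj T := tensorBeads (simplices X) T.unop
  map {U T} f :=
    refine X 0 U.unop.jointList (T.unop.jointList.map (FinInt.ev f.unop.toHom))
      (sublist_map f.unop) ≫
    active (X := X) f.unop.toHom 0 0 (FinInt.ev_zero _) _ T.unop.jointList rfl
  map_id T := by
    refine (refine_active_congr X (𝟙 T.unop.vertices) _ (map_id_jointList T.unop)
      (List.Sublist.refl _) (map_id_jointList T.unop)).trans ?_
    rw [refine_self, active_id X _ _ _ T.unop.pairwise_jointList, Category.id_comp]
  map_comp {V U T} g f := by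
    have hT := T.unop.pairwise_jointList
    have e : T.unop.jointList.map (FinInt.ev (f.unop.toHom ≫ g.unop.toHom)) =
        (T.unop.jointList.map (FinInt.ev f.unop.toHom)).map (FinInt.ev g.unop.toHom) := by
      rw [List.map_map]
      exact List.map_congr_left fun t _ => FinInt.ev_comp _ _ _
    refine (refine_active_congr X (f.unop.toHom ≫ g.unop.toHom) _ e
      ((sublist_map g.unop).trans ((sublist_map f.unop).map _)) e).trans ?_
    rw [← active_comp X f.unop.toHom g.unop.toHom 0 0 0 (FinInt.ev_zero _) (FinInt.ev_zero _)
      (FinInt.ev_zero _) _ _ _ hT rfl rfl e, Category.assoc,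
      ← refine_comp X 0 _ _ _ (pairwise_map _ (pairwise_map _ hT)) (sublist_map g.unop)
        ((sublist_map f.unop).map _), Category.assoc,
      ← reassoc_of% (active_refine X g.unop.toHom 0 0 (FinInt.ev_zero _) _ _ _ _
        (pairwise_map f.unop.toHom hT) (pairwise_map _ (pairwise_map _ hT)) rfl rfl
        (sublist_map f.unop) ((sublist_map f.unop).map _))]

end

end Necklace

/-! ### Templicial objects -/

/-- A templicial object in `V` with set of vertices `S`: a strongly unital colax monoidal functor
from the opposite of the category of finite intervals to the `V`-enriched quivers on `S`. -/
structure TemplicialObject (V : Type u) [Category.{v} V] [MonoidalCategory V] [SymmetricCategory V]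
    [MonoidalClosed V] [HasColimits V] (S : Type v) where
  functor : FinIntᵒᵖ ⥤ VQuiv V S
  [colax : functor.OplaxMonoidal]
  [unital : IsIso (Functor.OplaxMonoidal.η functor)]

attribute [instance] TemplicialObject.colax TemplicialObject.unital

/-! ### Degenerate simplices -/

/-- The surjective order morphisms `[m] → [n]`. They automatically preserve the endpoints. -/
def surjective : MorphismProperty FinInt := fun _ _ f => Function.Surjective f.toOrderHom

instance : surjective.IsMultiplicative where
  id_mem _ := Function.surjective_id
  comp_mem _ _ hf hg := hg.comp hf

/-- The category of the `[n]` with the surjective order morphisms. -/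
abbrev SimplexSurj := WideSubcategory surjective

/-- The category of surjections `σ : [n] → [k]` with `k < n`. -/
abbrev ProperQuotient (n : SimplexSurj) :=
  ObjectProperty.FullSubcategory fun σ : Under n => σ.right.obj.len < n.obj.len

section Degenerate

variable {W : Type*} [Category* W] [HasColimitsOfSize.{0, 0} W] (Y : SimplexSurjᵒᵖ ⥤ W)

/-- The diagram `(σ : [n] → [k]) ↦ Y_k`. -/
abbrev degenerateDiagram (n : SimplexSurj) : (ProperQuotient n)ᵒᵖ ⥤ W :=
  (ObjectProperty.ι _ ⋙ Under.forget n).op ⋙ Y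

/-- `Y_n^deg`, the colimit of `Y_k` over the surjections `[n] → [k]` with `k < n`. -/
def degenerate (n : SimplexSurj) : W := colimit (degenerateDiagram Y n)

/-- The canonical morphism `Y_n^deg → Y_n`. -/
def degenerateMap (n : SimplexSurj) : degenerate Y n ⟶ Y.obj (op n) :=
  colimit.desc (degenerateDiagram Y n)
    { pt := Y.obj (op n)
      ι :=
        { app := fun σ => Y.map σ.unop.obj.hom.op
          naturality := fun σ τ f => by
            have h := Under.w f.unop.hom
            change Y.map f.unop.hom.right.op ≫ Y.map τ.unop.obj.hom.op =
              Y.map σ.unop.obj.hom.op ≫ 𝟙 _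
            rw [Category.comp_id, ← Y.map_comp, ← op_comp, h] } }

end Degenerate

/-! ### Flags -/

namespace Necklace

/-- The poset `P_T` of the subsets `U` of `[p]` with `T ⊆ U`, ordered by inclusion. -/
abbrev Poset (T : Necklace) := { U : Finset ℕ // T.joints ⊆ U ∧ ∀ u ∈ U, u ≤ T.last }

/-- The functor `T ↦ P_T`, sending a necklace map `f` to `U ↦ f(U)`. -/
def posetFunctor : Necklace ⥤ PartOrd.{0} where
  obj T := PartOrd.of T.Poset
  map {T U} f := PartOrd.ofHom
    { toFun A := ⟨A.1.image (FinInt.ev f.toHom),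
        f.joints_subset.trans (Finset.image_subset_image A.2.1), fun u hu => by
          obtain ⟨t, _, rfl⟩ := Finset.mem_image.1 hu
          exact FinInt.ev_le _ _⟩
      monotone' := fun A B h => Finset.image_subset_image h }
  map_id T := by
    refine PartOrd.ext fun A => ?_
    exact Subtype.ext (image_id T A.1 A.2.2)
  map_comp f g := by
    refine PartOrd.ext fun A => ?_
    exact Subtype.ext (image_comp f.toHom g.toHom A.1)

/-- The functor `T ↦ N(P_T)`. The `n`-simplices of `N(P_T)` are the flags of length `n` on `T`. -/
def flags : Necklace ⥤ SSet.{0} := posetFunctor ⋙ PartOrd.nerveFunctor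

end Necklace

/-- A necklace `T` with a flanked flag of length `n`, that is a sequence `T₀ ⊆ … ⊆ Tₙ` with
`T₀ = T` and `Tₙ = [p]`. -/
structure FlankedFlag (n : ℕ) where
  necklace : Necklace
  flag : ComposableArrows necklace.Poset n
  first : (flag.obj 0).1 = necklace.joints
  last : (flag.obj (Fin.last n)).1 = Finset.range (necklace.last + 1)

/-! ### Categorification -/

section Categorification

variable (V : Type u) [Category.{v} V] [MonoidalCategory V] [HasColimits V]

/-- The functor `F : Set → V` sending a set to a coproduct of copies of `I`. -/
def free : Type ⥤ V := sigmaConst.obj (𝟙_ V)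

/-- The functor `T ↦ F N(P_T)`. -/
def freeFlags : Necklace ⥤ SimplicialObject V :=
  Necklace.flags ⋙ (SimplicialObject.whiskering (Type) V).obj (free V)

/-- The tensoring of simplicial objects over `V`, given by `(A · Y)_n = A ⊗ Y_n`. -/
def tensoring : V ⥤ SimplicialObject V ⥤ SimplicialObject V :=
  curriedTensor V ⋙ SimplicialObject.whiskering V V

variable {V}

/-- The weighted colimit of `G` with weight `Y`, as the coequaliser of
`∐_{f : T → U} Y_U · G_T ⇉ ∐_T Y_T · G_T`. -/
def weightedColimit (Y : Necklaceᵒᵖ ⥤ V) (G : Necklace ⥤ SimplicialObject V) : SimplicialObject V :=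
  coequalizer
    (Sigma.desc fun f : Σ T U : Necklace, T ⟶ U =>
      ((tensoring V).map (Y.map f.2.2.op)).app (G.obj f.1) ≫
        Sigma.ι (fun T : Necklace => ((tensoring V).obj (Y.obj (op T))).obj (G.obj T)) f.1)
    (Sigma.desc fun f : Σ T U : Necklace, T ⟶ U =>
      ((tensoring V).obj (Y.obj (op f.2.1))).map (G.map f.2.2) ≫
        Sigma.ι (fun T : Necklace => ((tensoring V).obj (Y.obj (op T))).obj (G.obj T)) f.2.1)

end Categorification

namespace TemplicialObject

variable {V : Type u} [Category.{v} V] [MonoidalCategory V] [SymmetricCategory V]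
  [MonoidalClosed V] [HasColimits V] {S : Type v} (X : TemplicialObject V S)

/-- The quiver `X_n`. -/
abbrev obj (n : ℕ) : VQuiv V S := X.functor.obj (op ⟨n⟩)

/-- The restriction of `X` to surjective morphisms. -/
def restrict : SimplexSurjᵒᵖ ⥤ VQuiv V S := (wideSubcategoryInclusion surjective).op ⋙ X.functor

/-- The canonical morphism `X_n^deg → X_n` from the quiver of degenerate `n`-simplices. -/
def degMap (n : ℕ) : degenerate X.restrict ⟨⟨n⟩⟩ ⟶ X.obj n := degenerateMap X.restrict ⟨⟨n⟩⟩

/-- `X` has non-degenerate simplices: for every `n` there is a quiver `X_n^nd` such that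
`X_n^deg → X_n` is, up to isomorphism, the coprojection `X_n^deg → X_n^deg ⨿ X_n^nd`. The quivers
`X_n^nd`, together with the complementary coprojections, are part of the data. -/
structure NonDegenerate where
  nd : ℕ → VQuiv V S
  incl : ∀ n, nd n ⟶ X.obj n
  isColimit : ∀ n, Nonempty (IsColimit (BinaryCofan.mk (X.degMap n) (incl n)))

/-- The functor `T ↦ X_T(a, b)` on necklaces. -/
def nec (a b : S) : Necklaceᵒᵖ ⥤ V := Necklace.necklaceFunctor X.functor ⋙ VQuiv.eval V a b

/-- The simplicial hom-object of the categorification of `X` from `a` to `b`: the weighted colimit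
of `T ↦ F N(P_T)` with weight `T ↦ X_T(a, b)`. -/
def categorification (a b : S) : SimplicialObject V := weightedColimit (X.nec a b) (freeFlags V)

/-- `X_T^nd = X_{t₁}^nd ⊗ X_{t₂ - t₁}^nd ⊗ … ⊗ X_{p - tₖ₋₁}^nd`. -/
def NonDegenerate.ndNecklace {X : TemplicialObject V S} (N : X.NonDegenerate) (T : Necklace) :
    VQuiv V S :=
  Necklace.tensorBeads N.nd T

end TemplicialObject

end Templicial

end

/-! The degree `n` part of the categorification is an ordinary colimit, which is first cut down to
flanked flags and then decomposed into non-degenerate pieces.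

Let `E` be the category of elements of `T ↦ N(P_T)_n`: its objects are pairs `(T, x)` with `x` a
flag of length `n` on `T`, and its morphisms `(T, x) → (U, y)` are the necklace maps `f` with `f(x)
= y`. Since `F N(P_T)_n` is a coproduct of copies of `I` indexed by flags, the coequaliser says that
`C[X]_n(a, b)` is the colimit of `(T, x) ↦ X_T(a, b)` over the opposite of `E` (`map_elementInc`,
`element_ext`, `exists_element_desc`).

The flanked flags form a coreflective full subcategory of `E`: discarding the vertices outside the
last set of a flag, and taking its first set as joints, gives the universal flanked flag mapping to
it (`Flag.exists_core`). The colimit may therefore be computed over flanked flags alone, and the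
morphisms between these are exactly the surjective necklace maps `f : T → U` with `U = f(T)`, the
active surjections.

On the other side, `X_T` is the coproduct of the `X_U^nd` over all active surjections `T → U`
(`isCoprod_necklace`). By induction on `n`, `X_n` is the coproduct of the `X_k^nd` over the
surjections `[n] → [k]` (`isCoprod_of_nonDegenerate`). The tensor product distributes over
coproducts, so `X_T` is a coproduct over tuples of surjections, one for each bead. Such a tuple is
the same as one active surjection out of `T` (`toBeads_bijective`), and beads collapsed to a point
contribute only the unit, as `X_0^nd ≅ X_0 ≅ I_S` (`exists_iso_zero`, `exists_iso_refine`).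

Hence on flanked flags the diagram is a coproduct, over flanked flags `(U, y)`, of copies of
`X_U^nd(a, b)` indexed by the morphisms `(T, x) → (U, y)`. The colimit of a representable functor is
a point, so exactly one copy of `X_U^nd(a, b)` survives for each `(U, y)`.
`isCoprod_categorification` carries out this argument directly on morphisms out of the colimit. -/

noncomputable section

namespace Templicial

/-! ### Coproduct diagrams -/

section IsCoprod

variable {C : Type*} [Category* C]

/-- The morphisms `ι i : A i ⟶ B` exhibit `B` as a coproduct of the `A i`. -/
structure IsCoprod {I : Type*} {A : I → C} {B : C} (ι : ∀ i, A i ⟶ B) : Prop where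
  hom_ext : ∀ {Z : C} {f g : B ⟶ Z}, (∀ i, ι i ≫ f = ι i ≫ g) → f = g
  exists_desc : ∀ {Z : C} (φ : ∀ i, A i ⟶ Z), ∃ d : B ⟶ Z, ∀ i, ι i ≫ d = φ i

namespace IsCoprod

variable {I : Type*} {A : I → C} {B : C} {ι : ∀ i, A i ⟶ B}

lemma of_isColimit (h : IsColimit (Cofan.mk B ι)) : IsCoprod ι where
  hom_ext e := h.hom_ext fun ⟨i⟩ => e i
  exists_desc φ := ⟨h.desc (Cofan.mk _ φ), fun i => h.fac (Cofan.mk _ φ) ⟨i⟩⟩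

lemma sigma {A : I → C} [HasCoproduct A] : IsCoprod (Sigma.ι A) :=
  of_isColimit (coproductIsCoproduct A)

/-- A choice of morphism out of a coproduct. -/
def desc (h : IsCoprod ι) {Z : C} (φ : ∀ i, A i ⟶ Z) : B ⟶ Z := (h.exists_desc φ).choose

@[simp]
lemma ι_desc (h : IsCoprod ι) {Z : C} (φ : ∀ i, A i ⟶ Z) (i : I) : ι i ≫ h.desc φ = φ i :=
  (h.exists_desc φ).choose_spec i

/-- The limiting property of a coproduct diagram. -/
def isColimit (h : IsCoprod ι) : IsColimit (Cofan.mk B ι) :=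
  Cofan.IsColimit.mk _ (fun s => h.desc s.inj) (fun s i => h.ι_desc s.inj i)
    fun s _ hm => h.hom_ext fun i => (hm i).trans (h.ι_desc s.inj i).symm

lemma reindex (h : IsCoprod ι) {J : Type*} (e : J → I) (he : Function.Bijective e) :
    IsCoprod fun j => ι (e j) := by
  obtain ⟨e, rfl⟩ : ∃ e' : J ≃ I, e = e' := ⟨Equiv.ofBijective e he, rfl⟩
  refine ⟨fun hfg => h.hom_ext fun i => ?_, fun {Z} φ => ?_⟩
  · obtain ⟨j, rfl⟩ := e.surjective i
    exact hfg j
  · have key : ∀ i, ∃ ψ : A i ⟶ Z, ∀ j (hj : e j = i), ψ = eqToHom (by rw [hj]) ≫ φ j := by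
      intro i
      obtain ⟨j, rfl⟩ := e.surjective i
      refine ⟨φ j, fun j' hj => ?_⟩
      obtain rfl := e.injective hj
      simp
    choose ψ hψ using key
    refine ⟨h.desc ψ, fun j => ?_⟩
    rw [ι_desc, hψ _ j rfl]
    simp

lemma of_iso (h : IsCoprod ι) {A' : I → C} {ι' : ∀ i, A' i ⟶ B} (e : ∀ i, A' i ≅ A i)
    (he : ∀ i, (e i).hom ≫ ι i = ι' i) : IsCoprod ι' where
  hom_ext hfg := h.hom_ext fun i => by
    have := hfg i
    rwa [← he, Category.assoc, Category.assoc, cancel_epi] at this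
  exists_desc φ := ⟨h.desc fun i => (e i).inv ≫ φ i, fun i => by rw [← he]; simp⟩

lemma map {D : Type*} [Category* D] (F : C ⥤ D) (h : IsCoprod ι)
    [PreservesColimit (Discrete.functor A) F] : IsCoprod fun i => F.map (ι i) :=
  of_isColimit (isColimitCofanMkObjOfIsColimit F A ι h.isColimit)

/-- A coproduct of coproducts. -/
lemma comp (h : IsCoprod ι) {J : I → Type*} {A' : ∀ i, J i → C} {κ : ∀ i j, A' i j ⟶ A i}
    (h' : ∀ i, IsCoprod (κ i)) : IsCoprod fun p : Σ i, J i => κ p.1 p.2 ≫ ι p.1 where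
  hom_ext hfg := h.hom_ext fun i => (h' i).hom_ext fun j => by simpa using hfg ⟨i, j⟩
  exists_desc φ := ⟨h.desc fun i => (h' i).desc fun j => φ ⟨i, j⟩, fun p => by simp⟩

section Monoidal

variable [MonoidalCategory C] [MonoidalClosed C]

lemma whiskerLeft (h : IsCoprod ι) (R : C) : IsCoprod fun i => R ◁ ι i :=
  h.map (tensorLeft R)

variable [SymmetricCategory C]

lemma whiskerRight (h : IsCoprod ι) (R : C) : IsCoprod fun i => ι i ▷ R :=
  have : PreservesColimit (Discrete.functor A) (tensorRight R) :=
    preservesColimit_of_natIso _ (BraidedCategory.tensorLeftIsoTensorRight R)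
  h.map (tensorRight R)

/-- Closedness and symmetry make tensoring on either side preserve coproducts, so the product can be
expanded first in the left factor and then in the right one. -/
lemma tensor (h : IsCoprod ι) {J : Type*} {A' : J → C} {B' : C} {κ : ∀ j, A' j ⟶ B'}
    (h' : IsCoprod κ) : IsCoprod fun p : I × J => ι p.1 ⊗ₘ κ p.2 := by
  have := ((h.whiskerRight B').comp fun i => h'.whiskerLeft (A i)).reindex
    (Equiv.sigmaEquivProd I J).symm (Equiv.bijective _)
  exact this.of_iso (fun p => Iso.refl _) fun p =>
    (Category.id_comp _).trans (MonoidalCategory.tensorHom_def' _ _).symm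

end Monoidal

end IsCoprod

end IsCoprod

/-! ### Coproducts of quivers and of their tensor products -/

namespace VQuiv

variable {V : Type u} [Category.{v} V] {S : Type v}

/-- Colimits of quivers are computed at each pair of vertices, so evaluation preserves them. The
coproducts are required in `V` because the given diagram is compared with the pointwise one. -/
lemma isCoprod_app {I : Type*} [HasCoproductsOfShape I V] {A : I → VQuiv V S} {B : VQuiv V S}
    {ι : ∀ i, A i ⟶ B} (h : IsCoprod ι) (a b : S) : IsCoprod fun i => (ι i).app a b :=
  have : PreservesColimit (Discrete.functor A) (eval V a b) :=
    preservesColimit_of_preserves_colimit_cocone (colimitCocone (Discrete.functor A)).isColimit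
      (colimit.isColimit (Discrete.functor A ⋙ eval V a b))
  h.map (eval V a b)

lemma isCoprod_of_app {I : Type*} {A : I → VQuiv V S} {B : VQuiv V S}
    {ι : ∀ i, A i ⟶ B} (h : ∀ a b, IsCoprod fun i => (ι i).app a b) : IsCoprod ι where
  hom_ext hfg := by
    ext a b
    exact (h a b).hom_ext fun i => congrArg (fun f => Hom.app f a b) (hfg i)
  exists_desc φ := ⟨⟨fun a b => (h a b).desc fun i => (φ i).app a b⟩, fun i => by
    ext a b
    exact (h a b).ι_desc _ i⟩

variable [MonoidalCategory V] [SymmetricCategory V] [MonoidalClosed V] [HasColimits V]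

/-- At each middle vertex `c` this is distributivity in `V`, and the coproduct over `c` commutes
with the coproduct over pairs of indices. -/
lemma isCoprod_tensor {I J : Type*} [HasCoproductsOfShape I V] [HasCoproductsOfShape J V]
    {P : I → VQuiv V S} {P' : VQuiv V S} {Q : J → VQuiv V S} {Q' : VQuiv V S}
    {ι : ∀ i, P i ⟶ P'} {κ : ∀ j, Q j ⟶ Q'} (h : IsCoprod ι) (h' : IsCoprod κ) :
    IsCoprod fun p : I × J => ι p.1 ⊗ₘ κ p.2 := by
  have H (a b c : S) := (isCoprod_app h a c).tensor (isCoprod_app h' c b)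
  refine isCoprod_of_app fun a b => ⟨fun {Z f g} hfg => tinc_ext fun c => (H a b c).hom_ext
    fun p => ?_, fun {Z} φ => ?_⟩
  · have := tinc _ _ a c b ≫= hfg p
    rwa [tinc_tensorHom_assoc, tinc_tensorHom_assoc] at this
  · let d : (P' ⊗ Q').obj a b ⟶ Z :=
      Sigma.desc fun c => (H a b c).desc fun p => tinc (P p.1) (Q p.2) a c b ≫ φ p
    have hd (c : S) : tinc P' Q' a c b ≫ d =
        (H a b c).desc fun p => tinc (P p.1) (Q p.2) a c b ≫ φ p := Sigma.ι_desc _ _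
    refine ⟨d, fun p => tinc_ext fun c => ?_⟩
    rw [tinc_tensorHom_assoc, hd]
    exact (H a b c).ι_desc _ p

end VQuiv

/-! ### Simplices as a coproduct of non-degenerate simplices -/

namespace FinInt

lemma exists_ev_of_surjective {m n : FinInt} {f : m ⟶ n} (hf : surjective f) {j : ℕ}
    (hj : j ≤ n.len) : ∃ i ≤ m.len, ev f i = j := by
  obtain ⟨i, hi⟩ := hf ⟨j, by omega⟩
  exact ⟨i, by omega, by rw [ev_fin, hi]⟩

lemma surjective_of_exists_ev {m n : FinInt} {f : m ⟶ n} (hf : ∀ j ≤ n.len, ∃ i, ev f i = j) :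
    surjective f := fun j => by
  obtain ⟨i, hi⟩ := hf j (by omega)
  exact ⟨_, Fin.ext hi⟩

lemma len_le_of_surjective {m n : FinInt} {f : m ⟶ n} (hf : surjective f) : n.len ≤ m.len := by
  simpa using Fintype.card_le_of_surjective _ hf

/-- A surjective endomap of a finite set is injective, so the map is an order automorphism of a
finite chain, and the identity is the only one. -/
lemma eq_id_of_surjective {m : FinInt} {f : m ⟶ m} (hf : surjective f) : f = 𝟙 m := by
  have h : StrictMono f.toOrderHom :=
    f.toOrderHom.monotone.strictMono_of_injective (Finite.injective_iff_surjective.2 hf)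
  apply Hom.ext
  have := Subsingleton.elim
    (StrictMono.orderIsoOfSurjective f.toOrderHom h hf) (OrderIso.refl _)
  ext i
  exact congrArg Fin.val (DFunLike.congr_fun this i)

end FinInt

section Degenerate

variable {W : Type*} [Category* W] [HasColimitsOfSize.{0, 0} W] (Y : SimplexSurjᵒᵖ ⥤ W)

/-- The coprojection of `Y_k` in `Y_n^deg` at a surjection `[n] → [k]`. -/
def degenerateInc {n k : SimplexSurj} (σ : n ⟶ k) (h : k.obj.len < n.obj.len) :
    Y.obj (op k) ⟶ degenerate Y n :=
  colimit.ι (degenerateDiagram Y n) (op ⟨Under.mk σ, h⟩)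

lemma degenerateInc_map {n k : SimplexSurj} (σ : n ⟶ k) (h : k.obj.len < n.obj.len) :
    degenerateInc Y σ h ≫ degenerateMap Y n = Y.map σ.op :=
  colimit.ι_desc _ _

variable {Y} in
lemma degenerate_ext {n : SimplexSurj} {Z : W} {f g : degenerate Y n ⟶ Z}
    (hfg : ∀ (k : SimplexSurj) (σ : n ⟶ k) (h : k.obj.len < n.obj.len),
      degenerateInc Y σ h ≫ f = degenerateInc Y σ h ≫ g) : f = g :=
  colimit.hom_ext fun σ => hfg σ.unop.obj.right σ.unop.obj.hom σ.unop.property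

/-- A morphism under `n` out of `σ` is a surjection `τ` with target `σ ≫ τ`, so compatibility on
composable pairs is the whole cocone condition. -/
lemma exists_degenerate_desc {n : SimplexSurj} {Z : W}
    (φ : ∀ k : SimplexSurj, k.obj.len < n.obj.len → (n ⟶ k) → (Y.obj (op k) ⟶ Z))
    (hφ : ∀ (k l : SimplexSurj) (hk : k.obj.len < n.obj.len) (hl : l.obj.len < n.obj.len)
      (σ : n ⟶ k) (τ : k ⟶ l), Y.map τ.op ≫ φ k hk σ = φ l hl (σ ≫ τ)) :
    ∃ d : degenerate Y n ⟶ Z, ∀ (k : SimplexSurj) (σ : n ⟶ k) (h : k.obj.len < n.obj.len),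
      degenerateInc Y σ h ≫ d = φ k h σ := by
  refine ⟨colimit.desc (degenerateDiagram Y n)
    { pt := Z
      ι :=
        { app := fun σ => φ σ.unop.obj.right σ.unop.property σ.unop.obj.hom
          naturality := fun σ τ f => ?_ } }, fun k σ h => colimit.ι_desc _ _⟩
  refine (hφ _ _ τ.unop.property σ.unop.property τ.unop.obj.hom f.unop.hom.right).trans ?_
  have e : τ.unop.obj.hom ≫ f.unop.hom.right = σ.unop.obj.hom := Under.w f.unop.hom
  exact (congrArg (φ _ σ.unop.property) e).trans (Category.comp_id _).symm

/-- If `Y_n^deg → Y_n` is complemented by `nd n` for every `n`, then `Y_n` is the coproduct of the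
`nd k` over the surjections `[n] → [k]`. -/
lemma isCoprod_of_nonDegenerate (nd : ℕ → W) (incl : ∀ n, nd n ⟶ Y.obj (op ⟨⟨n⟩⟩))
    (h : ∀ n, Nonempty (IsColimit (BinaryCofan.mk (degenerateMap Y ⟨⟨n⟩⟩) (incl n)))) (n : ℕ) :
    IsCoprod fun σ : Σ k : ℕ, ((⟨⟨n⟩⟩ : SimplexSurj) ⟶ ⟨⟨k⟩⟩) => incl σ.1 ≫ Y.map σ.2.op := by
  induction n using Nat.strong_induction_on with
  | _ n ih =>
  have h_ext {Z : W} {f g : Y.obj (op ⟨⟨n⟩⟩) ⟶ Z}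
      (h1 : degenerateMap Y ⟨⟨n⟩⟩ ≫ f = degenerateMap Y ⟨⟨n⟩⟩ ≫ g)
      (h2 : incl n ≫ f = incl n ≫ g) : f = g :=
    BinaryCofan.IsColimit.hom_ext (h n).some h1 h2
  have h_desc {Z : W} (f : degenerate Y ⟨⟨n⟩⟩ ⟶ Z) (g : nd n ⟶ Z) :
      ∃ d : Y.obj (op ⟨⟨n⟩⟩) ⟶ Z, degenerateMap Y ⟨⟨n⟩⟩ ≫ d = f ∧ incl n ≫ d = g :=
    ⟨_, (BinaryCofan.IsColimit.desc' (h n).some f g).2⟩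
  -- For uniqueness, a component `τ` of `Y_k`, reached from the degenerate part through `σ : [n] →
  -- [k]`, is the component `σ ≫ τ` of `Y_n`. The non-degenerate part is the component at the
  -- identity.
  refine ⟨fun {Z f g} hfg => h_ext ?_ ?_, fun {Z} φ => ?_⟩
  · refine degenerate_ext fun k σ hk => (ih k.obj.len hk).hom_ext fun τ => ?_
    have := hfg ⟨τ.1, σ ≫ τ.2⟩
    simp only [op_comp, Y.map_comp, Category.assoc] at this
    rw [reassoc_of% degenerateInc_map, reassoc_of% degenerateInc_map, Category.assoc,
      Category.assoc]
    exact this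
  · have := hfg ⟨n, 𝟙 _⟩
    rw [op_id, Y.map_id, Category.comp_id] at this
    exact this
  · obtain ⟨φ, rfl⟩ : ∃ φ' : ∀ (k : ℕ) (σ : (⟨⟨n⟩⟩ : SimplexSurj) ⟶ ⟨⟨k⟩⟩), nd k ⟶ Z,
      φ = fun σ : Σ k : ℕ, ((⟨⟨n⟩⟩ : SimplexSurj) ⟶ ⟨⟨k⟩⟩) => φ' σ.1 σ.2 :=
        ⟨fun k σ => φ ⟨k, σ⟩, rfl⟩
    -- On the copy of `Y_k` at `σ` the morphism is forced: its component at `τ` must be `φ` at `σ ≫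
    -- τ`. The induction hypothesis assembles these components.
    have key (k : SimplexSurj) (hk : k.obj.len < n) (σ : ⟨⟨n⟩⟩ ⟶ k) :=
      (ih k.obj.len hk).exists_desc fun τ => φ τ.1 (σ ≫ τ.2)
    choose ψ hψ using key
    -- Both sides of the compatibility condition have component `φ` at `σ ≫ τ ≫ ρ` for every `ρ`. No
    -- Eilenberg–Zilber pushouts of surjections are needed.
    obtain ⟨d, hd⟩ := exists_degenerate_desc Y (n := ⟨⟨n⟩⟩) ψ fun k l hk hl σ τ =>
      (ih l.obj.len hl).hom_ext fun ρ => by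
        have := hψ k hk σ ⟨ρ.1, τ ≫ ρ.2⟩
        simp only [op_comp, Y.map_comp, Category.assoc] at this
        rw [hψ l hl (σ ≫ τ) ρ, Category.assoc, Category.assoc]
        exact this
    obtain ⟨d', hd1, hd2⟩ := h_desc d (φ n (𝟙 _))
    refine ⟨d', fun ⟨k, σ⟩ => ?_⟩
    -- For `k < n` the component factors through the degenerate part. Otherwise surjectivity forces
    -- `k = n` and `σ = 𝟙`.
    rcases lt_or_ge k n with hk | hk
    · have := hψ ⟨⟨k⟩⟩ hk σ ⟨k, 𝟙 _⟩
      rw [op_id, Y.map_id, Category.comp_id, Category.comp_id] at this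
      change incl k ≫ _ = φ k σ at this
      change (incl k ≫ Y.map σ.op) ≫ d' = φ k σ
      rw [← this, ← hd ⟨⟨k⟩⟩ σ hk, ← hd1, reassoc_of% degenerateInc_map, Category.assoc]
    · obtain rfl : k = n := le_antisymm (FinInt.len_le_of_surjective σ.property) hk
      obtain rfl : σ = 𝟙 _ := WideSubcategory.hom_ext _ (FinInt.eq_id_of_surjective σ.property)
      rw [op_id, Y.map_id, Category.comp_id, hd2]

end Degenerate

/-! ### Active surjections out of a list of beads -/

/-- Tuples of surjections `[t₁ - s] → [k₁]`, `[t₂ - t₁] → [k₂]`, …, one for each bead of the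
list `[t₁, t₂, …]`. -/
@[reducible] def BeadSurj : ℕ → List ℕ → Type
  | _, [] => PUnit
  | s, t :: L => (Σ k : ℕ, ((⟨⟨t - s⟩⟩ : SimplexSurj) ⟶ ⟨⟨k⟩⟩)) × BeadSurj t L

namespace BeadSurj

open FinInt

/-- The map on vertices given by a tuple of surjections, sending `s` to `r`. -/
def ev : (s r : ℕ) → (L : List ℕ) → BeadSurj s L → ℕ → ℕ
  | _, r, [], _, _ => r
  | s, r, t :: L, σ, i => if i ≤ t then r + FinInt.ev σ.1.2.hom (i - s) else
      ev t (r + σ.1.1) L σ.2 i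

lemma ev_start (s r : ℕ) (L : List ℕ) (hL : (s :: L).Pairwise (· ≤ ·)) (σ : BeadSurj s L) :
    ev s r L σ s = r := by
  cases L with
  | nil => rfl
  | cons t L => simp [ev, (List.pairwise_cons.1 hL).1 t (by simp)]

/-- The two clauses of `ev` agree at the shared joint `t`, so the second one may also be used there.
-/
lemma ev_cons_of_ge {s r t : ℕ} {L : List ℕ} (hL : (s :: t :: L).Pairwise (· ≤ ·))
    (σ : BeadSurj s (t :: L)) {i : ℕ} (hi : t ≤ i) :
    ev s r (t :: L) σ i = ev t (r + σ.1.1) L σ.2 i := by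
  rcases hi.eq_or_lt with rfl | hi
  · rw [ev_start _ _ _ (List.pairwise_cons.1 hL).2, ev, if_pos le_rfl, ev_of_le _ le_rfl]
  · rw [ev, if_neg (by omega)]

lemma ev_mono (s r : ℕ) (L : List ℕ) (hL : (s :: L).Pairwise (· ≤ ·)) (σ : BeadSurj s L) :
    ∀ i j, s ≤ i → i ≤ j → ev s r L σ i ≤ ev s r L σ j := by
  induction L generalizing s r with
  | nil => exact fun _ _ _ _ => le_rfl
  | cons t L ih =>
    intro i j hi hij
    have hL2 := (List.pairwise_cons.1 hL).2
    rcases le_total i t with hit | hit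
    · rcases le_total j t with hjt | hjt
      · have := FinInt.ev_mono σ.1.2.hom (show i - s ≤ j - s by omega)
        simpa [ev, hit, hjt] using this
      · rw [ev_cons_of_ge hL σ hjt]
        have h1 := ih t (r + σ.1.1) hL2 σ.2 t j le_rfl hjt
        rw [ev_start _ _ _ hL2] at h1
        have h2 := FinInt.ev_le σ.1.2.hom (i - s)
        rw [ev, if_pos hit]
        exact (Nat.add_le_add_left h2 r).trans h1
    · rw [ev_cons_of_ge hL σ hit, ev_cons_of_ge hL σ (hit.trans hij)]
      exact ih t _ hL2 σ.2 i j hit hij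

/-- Each bead is mapped onto its target and consecutive images share an endpoint, so no value is
skipped. Bounding `j` by a value at some `i` avoids computing the total length of the targets. -/
lemma exists_ev (s r : ℕ) (L : List ℕ) (hL : (s :: L).Pairwise (· ≤ ·)) (σ : BeadSurj s L)
    (i j : ℕ) (hi : s ≤ i) (hr : r ≤ j) (hj : j ≤ ev s r L σ i) :
    ∃ i, s ≤ i ∧ ev s r L σ i = j := by
  induction L generalizing s r with
  | nil => exact ⟨s, le_rfl, by simp only [ev] at *; omega⟩
  | cons t L ih =>
    have hL2 := (List.pairwise_cons.1 hL).2
    have hst := (List.pairwise_cons.1 hL).1 t (by simp)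
    rcases le_total j (r + σ.1.1) with h | h
    · obtain ⟨i', hi', h'⟩ := exists_ev_of_surjective σ.1.2.property
        (show j - r ≤ σ.1.1 by omega)
      replace hi' : i' ≤ t - s := hi'
      refine ⟨s + i', by omega, ?_⟩
      rw [ev, if_pos (by omega), Nat.add_sub_cancel_left, h']
      omega
    · rcases le_total i t with hit | hit
      · rw [ev, if_pos hit] at hj
        have h2 : FinInt.ev σ.1.2.hom (i - s) ≤ σ.1.1 := FinInt.ev_le σ.1.2.hom (i - s)
        refine ⟨t, hst, ?_⟩
        rw [ev_cons_of_ge hL σ le_rfl, ev_start _ _ _ hL2]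
        omega
      · rw [ev_cons_of_ge hL σ hit] at hj
        obtain ⟨i', hit', h'⟩ := ih t _ hL2 σ.2 hit h hj
        exact ⟨i', hst.trans hit', by rw [ev_cons_of_ge hL σ hit', h']⟩

lemma res_surjective {m n : FinInt} {f : m ⟶ n} (hf : surjective f) (s t : ℕ) :
    surjective (res f s t _ _ rfl rfl) := surjective_of_exists_ev fun j hj => by
  replace hj : j ≤ FinInt.ev f t - FinInt.ev f s := hj
  have h0 : FinInt.ev (res f s t _ _ rfl rfl) 0 = 0 := by simp
  -- For `j > 0` the value looked for is `f s + j`. It is written as a truncated difference from `f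
  -- t` so that its bound by `n.len` is immediate in all cases; `j = 0` is attained at `0` and makes
  -- no use of `i`.
  obtain ⟨i, -, hi⟩ := exists_ev_of_surjective hf
    (show FinInt.ev f (if j = 0 then s else t) - (FinInt.ev f t - FinInt.ev f s - j) ≤ n.len from
      (Nat.sub_le _ _).trans (FinInt.ev_le _ _))
  rcases Nat.eq_zero_or_pos j with rfl | hj0
  · exact ⟨0, h0⟩
  · rw [if_neg (by omega)] at hi
    have h1 : s ≤ i := by
      by_contra h
      have := FinInt.ev_mono f (show i ≤ s by omega)
      omega
    refine ⟨i - s, ?_⟩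
    rw [ev_res]
    rcases le_total i t with h2 | h2
    · rw [show s + min (i - s) (t - s) = i by omega]
      omega
    · have h3 := FinInt.ev_mono f h2
      rcases le_total s t with h4 | h4
      · rw [show s + min (i - s) (t - s) = t by omega]
        omega
      · have := FinInt.ev_mono f h4
        omega

/-- The restrictions of a surjection to the beads. -/
def ofHom {m n : FinInt} (f : m ⟶ n) (hf : surjective f) : (s : ℕ) → (L : List ℕ) → BeadSurj s L
  | _, [] => PUnit.unit
  | s, t :: L => ⟨⟨FinInt.ev f t - FinInt.ev f s, ⟨res f s t _ _ rfl rfl, res_surjective hf s t⟩⟩,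
      ofHom f hf t L⟩

/-- Gluing the restrictions recovers the map, but only up to the last joint: beyond it the tuple
carries no information and `ev` is constant. -/
lemma ev_ofHom {m n : FinInt} (f : m ⟶ n) (hf : surjective f) (s r : ℕ) (L : List ℕ)
    (hL : (s :: L).Pairwise (· ≤ ·)) (hr : FinInt.ev f s = r) (i : ℕ) (hi : s ≤ i)
    (hi' : ∃ t ∈ s :: L, i ≤ t) : ev s r L (ofHom f hf s L) i = FinInt.ev f i := by
  subst hr
  induction L generalizing s with
  | nil =>
    obtain rfl : i = s := by simp at hi'; omega
    rfl
  | cons t L ih =>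
    have hL2 := (List.pairwise_cons.1 hL).2
    have hst := (List.pairwise_cons.1 hL).1 t (by simp)
    have h1 := FinInt.ev_mono f hst
    rcases le_total i t with hit | hit
    · rw [ev, if_pos hit]
      simp only [ofHom]
      rw [ev_res, show s + min (i - s) (t - s) = i by omega]
      have := FinInt.ev_mono f hi
      omega
    · rw [ev_cons_of_ge hL _ hit]
      simp only [ofHom]
      rw [Nat.add_sub_cancel' h1]
      refine ih t hL2 hit ?_
      obtain ⟨u, hu, hiu⟩ := hi'
      rcases List.mem_cons.1 hu with rfl | hu
      · exact ⟨t, by simp, by omega⟩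
      · exact ⟨u, hu, hiu⟩

/-- The value at the last vertex is the length of the target, so the values on vertices determine
the target as well as the map. -/
lemma sigma_ext {n : ℕ} {p q : Σ k : ℕ, ((⟨⟨n⟩⟩ : SimplexSurj) ⟶ ⟨⟨k⟩⟩)}
    (h : ∀ i ≤ n, FinInt.ev p.2.hom i = FinInt.ev q.2.hom i) : p = q := by
  obtain ⟨k, p⟩ := p
  obtain ⟨l, q⟩ := q
  have e := h n le_rfl
  dsimp only at e h
  rw [ev_of_le _ le_rfl, ev_of_le _ le_rfl] at e
  obtain rfl : k = l := e
  obtain rfl : p = q := WideSubcategory.hom_ext _ (FinInt.hom_ext h)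
  rfl

/-- Converse to `ev_ofHom`: on each bead the values of the glued map, minus the offset at its start,
give back the surjection of the tuple. -/
lemma ofHom_eq {m n : FinInt} (f : m ⟶ n) (hf : surjective f) (s r : ℕ) (L : List ℕ)
    (hL : (s :: L).Pairwise (· ≤ ·)) (σ : BeadSurj s L)
    (h : ∀ i, s ≤ i → (∃ t ∈ s :: L, i ≤ t) → FinInt.ev f i = ev s r L σ i) :
    ofHom f hf s L = σ := by
  induction L generalizing s r with
  | nil => rfl
  | cons t L ih =>
    have hL2 := (List.pairwise_cons.1 hL).2
    have hst := (List.pairwise_cons.1 hL).1 t (by simp)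
    have hs := h s le_rfl ⟨t, by simp, hst⟩
    rw [ev_start _ _ _ hL] at hs
    refine Prod.ext (sigma_ext fun i hi => ?_) (ih t (r + σ.1.1) hL2 σ.2 fun i hi hi' => ?_)
    · simp only [ofHom]
      rw [ev_res, hs, h _ (by omega) ⟨t, by simp, by omega⟩, ev, if_pos (by omega),
        show s + min i (t - s) - s = i by omega]
      omega
    · rw [h i (hst.trans hi) ?_, ev_cons_of_ge hL σ hi]
      obtain ⟨u, hu, hiu⟩ := hi'
      exact ⟨u, List.mem_cons_of_mem _ hu, hiu⟩

end BeadSurj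

/-- A surjective necklace map `T → U` with `U = f(T)`. -/
structure ActiveSurj (T : Necklace) where
  target : Necklace
  hom : T ⟶ target
  surj : surjective hom.toHom
  joints : target.joints = T.joints.image (FinInt.ev hom.toHom)

namespace ActiveSurj

variable {T : Necklace}

/-- The target is determined too: its last vertex is the value at `T.last`, and its joints are the
image of those of `T`. -/
lemma ext_of_ev {f g : ActiveSurj T}
    (h : ∀ i ≤ T.last, FinInt.ev f.hom.toHom i = FinInt.ev g.hom.toHom i) : f = g := by
  obtain ⟨U, f, hf, hU⟩ := f
  obtain ⟨R, g, hg, hR⟩ := g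
  dsimp only at h
  have e : U = R := by
    refine Necklace.ext ?_ ?_
    · have := h T.last le_rfl
      rwa [FinInt.ev_of_le _ le_rfl, FinInt.ev_of_le _ le_rfl] at this
    · rw [hU, hR]
      exact Finset.image_congr fun t ht => h t (T.le_last t ht)
  subst e
  obtain rfl : f = g := Necklace.hom_ext (FinInt.hom_ext h)
  rfl

lemma exists_le_jointList {i : ℕ} (hi : i ≤ T.last) : ∃ t ∈ 0 :: T.jointList, i ≤ t := by
  rcases Nat.eq_zero_or_pos T.last with h | h
  · exact ⟨0, by simp, by omega⟩
  · exact ⟨T.last, List.mem_cons_of_mem _ (Necklace.mem_jointList.2 ⟨h.ne', T.last_mem⟩), hi⟩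

/-- The restrictions of an active surjection to the beads. -/
def toBeads (f : ActiveSurj T) : BeadSurj 0 T.jointList :=
  BeadSurj.ofHom f.hom.toHom f.surj 0 T.jointList

/-- The inverse glues a tuple of surjections at the joints into one map `c` out of `[p]`, and takes
the images of the joints as joints of the target. -/
lemma toBeads_bijective : Function.Bijective (toBeads (T := T)) := by
  have hT := T.pairwise_jointList
  refine ⟨fun f g h => ext_of_ev fun i hi => ?_, fun σ => ?_⟩
  · have e := congrArg (fun σ => BeadSurj.ev 0 0 T.jointList σ i) h
    dsimp only [toBeads] at e
    rwa [BeadSurj.ev_ofHom _ _ 0 0 _ hT (FinInt.ev_zero _) i (Nat.zero_le _)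
        (exists_le_jointList hi),
      BeadSurj.ev_ofHom _ _ 0 0 _ hT (FinInt.ev_zero _) i (Nat.zero_le _)
        (exists_le_jointList hi)] at e
  · let c := BeadSurj.ev 0 0 T.jointList σ
    have hc : ∀ i j, i ≤ j → c i ≤ c j := fun i j =>
      BeadSurj.ev_mono 0 0 _ hT σ i j (Nat.zero_le _)
    have hc0 : c 0 = 0 := BeadSurj.ev_start 0 0 _ hT σ
    let f : T.vertices ⟶ ⟨c T.last⟩ := FinInt.homMk c (fun i j h _ => hc i j h) hc0 rfl
    have hf (i : ℕ) (hi : i ≤ T.last) : FinInt.ev f i = c i := by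
      rw [FinInt.ev_homMk, min_eq_left hi]
    let U : Necklace :=
      { last := c T.last
        joints := T.joints.image (FinInt.ev f)
        zero_mem := Finset.mem_image.2 ⟨0, T.zero_mem, FinInt.ev_zero f⟩
        last_mem := Finset.mem_image.2 ⟨T.last, T.last_mem, FinInt.ev_of_le f le_rfl⟩
        le_last := fun u hu => by
          obtain ⟨t, _, rfl⟩ := Finset.mem_image.1 hu
          exact FinInt.ev_le f t }
    have hs : surjective f := FinInt.surjective_of_exists_ev fun j hj => by
      obtain ⟨i, -, hi⟩ := BeadSurj.exists_ev 0 0 _ hT σ T.last j (Nat.zero_le _) (Nat.zero_le _) hj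
      rcases le_total i T.last with h | h
      · exact ⟨i, by rw [hf i h]; exact hi⟩
      -- A preimage found beyond `T.last` can be replaced by `T.last`, since `c T.last ≤ c i = j ≤ c
      -- T.last`.
      · refine ⟨T.last, ?_⟩
        have h1 : c i = j := hi
        have h2 := hc _ _ h
        replace hj : j ≤ c T.last := hj
        rw [hf _ le_rfl]
        omega
    refine ⟨⟨U, ⟨f, Finset.Subset.refl _⟩, hs, rfl⟩, BeadSurj.ofHom_eq _ hs 0 0 _ hT σ ?_⟩
    intro i _ hi
    refine hf i ?_
    obtain ⟨t, ht, hit⟩ := hi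
    rcases List.mem_cons.1 ht with rfl | ht
    · omega
    · exact hit.trans (T.le_last t (Necklace.mem_jointList.1 ht).2)

end ActiveSurj

/-! ### Necklaces as a coproduct of non-degenerate necklaces -/

section Paths

open FinInt

variable {W : Type*} [Category* W] [MonoidalCategory W]

/-- The tensor product of morphisms `A n ⟶ B n` along a list of joints. -/
def pathMap {A B : ℕ → W} (g : ∀ n, A n ⟶ B n) :
    (s : ℕ) → (L : List ℕ) → (pathTensor A s L ⟶ pathTensor B s L)
  | _, [] => 𝟙 _
  | s, t :: L => g (t - s) ⊗ₘ pathMap g t L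

namespace BeadSurj

/-- The tensor product of the objects `A k` at the targets of a tuple of surjections. -/
@[reducible] def obj (A : ℕ → W) : (s : ℕ) → (L : List ℕ) → BeadSurj s L → W
  | _, [], _ => 𝟙_ W
  | _, t :: L, σ => A σ.1.1 ⊗ obj A t L σ.2

variable (X : FinIntᵒᵖ ⥤ W) {A : ℕ → W} (g : ∀ n, A n ⟶ simplices X n)

/-- The tensor product of the morphisms `A k → X k → X (t - s)` induced by a tuple of
surjections. -/
def map : (s : ℕ) → (L : List ℕ) → (σ : BeadSurj s L) →
    (obj A s L σ ⟶ pathTensor (simplices X) s L)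
  | _, [], _ => 𝟙 _
  | _, t :: L, σ => (g σ.1.1 ≫ X.map σ.1.2.hom.op) ⊗ₘ map t L σ.2

/-- The active part of `X` at `f` is a tensor product of maps bead by bead, and these are the maps
used by `map`. The isomorphism only mediates between two recursive descriptions of the same tensor
product. -/
lemma exists_iso_ofHom {m n : FinInt} (f : m ⟶ n) (hf : surjective f) (r s : ℕ) (L' L : List ℕ)
    (h : FinInt.ev f s = r) (hL : L.map (FinInt.ev f) = L') :
    ∃ e : pathTensor A r L' ≅ obj A s L (ofHom f hf s L),
      e.hom ≫ map X g s L (ofHom f hf s L) = pathMap g r L' ≫ active (X := X) f r s h L' L hL := by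
  induction L generalizing r s L' with
  | nil =>
    subst hL
    exact ⟨Iso.refl _, rfl⟩
  | cons t L ih =>
    subst h hL
    obtain ⟨e, he⟩ := ih _ t _ rfl rfl
    refine ⟨whiskerLeftIso _ e, ?_⟩
    change (_ ◁ e.hom) ≫ ((g _ ≫ X.map (res f s t _ _ rfl rfl).op) ⊗ₘ map X g t L _) =
      (g _ ⊗ₘ pathMap g _ _) ≫ (X.map (res f s t _ _ rfl rfl).op ⊗ₘ active f _ t rfl _ L rfl)
    rw [tensorHom_comp_tensorHom, ← he, ← id_tensorHom, tensorHom_comp_tensorHom, Category.id_comp]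

variable [X.OplaxMonoidal] [IsIso (Functor.OplaxMonoidal.η X)]

/-- Omitting trivial beads. -/
lemma exists_iso_refine (u : 𝟙_ W ≅ A 0) (hu : u.hom ≫ g 0 = unitMap X 0) (r : ℕ) (M L : List ℕ)
    (hM : (r :: M).Pairwise (· < ·)) (hL : (r :: L).Pairwise (· ≤ ·)) (hML : M.Sublist L)
    (hLM : ∀ t ∈ L, t = r ∨ t ∈ M) :
    ∃ e : pathTensor A r M ≅ pathTensor A r L,
      e.hom ≫ pathMap g r L = pathMap g r M ≫ refine X r M L hML := by
  induction L generalizing r M with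
  | nil =>
    obtain rfl : M = [] := by simpa using hML
    exact ⟨Iso.refl _, by simp [pathMap, refine]⟩
  | cons t L ih =>
    have hL2 := (List.pairwise_cons.1 hL).2
    have hM1 := (List.pairwise_cons.1 hM).1
    -- `L` may repeat entries while `M` is strictly increasing. An entry equal to its predecessor
    -- `r` is a bead collapsed to a point, absent from `M`.
    by_cases htr : t = r
    · subst htr
      have hML' : M.Sublist L := by
        rcases List.sublist_cons_iff.1 hML with h | ⟨M', rfl, h⟩
        · exact h
        · exact absurd (hM1 t (by simp)) (lt_irrefl _)
      obtain ⟨e, he⟩ := ih t M hM hL2 hML' fun x hx => hLM x (List.mem_cons_of_mem _ hx)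
      -- The trivial bead has length `t - t`, which is only propositionally `0`, so the isomorphism
      -- is transported to any `k = 0`.
      have key : ∀ k, k = 0 → ∃ w : 𝟙_ W ≅ A k, w.hom ≫ g k = unitMap X k := by
        rintro _ rfl
        exact ⟨u, hu⟩
      obtain ⟨w, hw⟩ := key (t - t) (Nat.sub_self t)
      refine ⟨e ≪≫ (λ_ _).symm ≪≫ whiskerRightIso w _, ?_⟩
      change (e.hom ≫ (λ_ _).inv ≫ w.hom ▷ _) ≫ (g _ ⊗ₘ pathMap g t L) = _
      have e1 : (λ_ _).inv ≫ w.hom ▷ _ ≫ (g (t - t) ⊗ₘ pathMap g t L) =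
          pathMap g t L ≫ ins X t L := by
        rw [ins, leftUnitor_inv_naturality_assoc, ← hw, MonoidalCategory.tensorHom_def',
          ← whisker_exchange_assoc, comp_whiskerRight]
      -- Inserting a joint equal to the starting point amounts to refining first and then inserting
      -- the unit bead.
      have e2 : refine X t M (t :: L) hML = refine X t M L hML' ≫ ins X t L := by
        rw [ins_nat, ← refine_keep X t t (hML'.cons_cons t) hML', ins_refine X t _ hL]
      rw [Category.assoc, Category.assoc, e1, reassoc_of% he, e2]
    · have htM := (hLM t (by simp)).resolve_left htr
      have hrt : r < t := hM1 t htM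
      cases M with
      | nil => simp at htM
      | cons m M =>
        have hM2 := (List.pairwise_cons.1 hM).2
        -- Both `M` and `L` are sorted, and each contains the head of the other, so the heads agree.
        obtain rfl : m = t := by
          by_contra hmt
          have h1 := (List.pairwise_cons.1 hM2).1 t (by simpa [Ne.symm hmt] using htM)
          have h2 := (List.pairwise_cons.1 hL2).1 m ((sublist_of_ne hML hmt).subset (by simp))
          omega
        have hML' : M.Sublist L := by simpa using hML
        obtain ⟨e, he⟩ := ih m M hM2 hL2 hML' fun x hx => by
          have h1 := (List.pairwise_cons.1 hL2).1 x hx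
          have h2 := hLM x (List.mem_cons_of_mem _ hx)
          rw [List.mem_cons] at h2
          exact h2.resolve_left (by omega)
        refine ⟨whiskerLeftIso _ e, ?_⟩
        change (_ ◁ e.hom) ≫ (g _ ⊗ₘ pathMap g m L) = (g _ ⊗ₘ pathMap g m M) ≫ _
        rw [refine_keep X r m hML hML', ← id_tensorHom, ← id_tensorHom, tensorHom_comp_tensorHom,
          tensorHom_comp_tensorHom, he, Category.id_comp, Category.comp_id]

end BeadSurj

end Paths

namespace TemplicialObject.NonDegenerate

variable {V : Type u} [Category.{v} V] [MonoidalCategory V] [SymmetricCategory V]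
  [MonoidalClosed V] [HasColimits V] {S : Type v} {X : TemplicialObject V S} (N : X.NonDegenerate)

lemma isCoprod_simplices (n : ℕ) :
    IsCoprod fun σ : Σ k : ℕ, ((⟨⟨n⟩⟩ : SimplexSurj) ⟶ ⟨⟨k⟩⟩) =>
      N.incl σ.1 ≫ X.functor.map σ.2.hom.op :=
  isCoprod_of_nonDegenerate X.restrict N.nd N.incl N.isColimit n

/-- There are no degenerate `0`-simplices. -/
lemma exists_iso_zero : ∃ u : 𝟙_ (VQuiv V S) ≅ N.nd 0, u.hom ≫ N.incl 0 = unitMap X.functor 0 := by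
  have h := N.isCoprod_simplices 0
  -- The identity is the only surjection out of `[0]`, so the coproduct decomposition of `X_0` has
  -- the single component `incl 0`.
  have key (σ : Σ k : ℕ, ((⟨⟨0⟩⟩ : SimplexSurj) ⟶ ⟨⟨k⟩⟩)) : σ = ⟨0, 𝟙 _⟩ :=
    BeadSurj.sigma_ext fun i hi => by
      obtain rfl : i = 0 := by omega
      rw [FinInt.ev_zero, FinInt.ev_zero]
  have hI : IsIso (N.incl 0) := by
    obtain ⟨d, hd⟩ := h.exists_desc fun σ => eqToHom (congrArg N.nd (congrArg Sigma.fst (key σ)))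
    have hd0 : N.incl 0 ≫ d = 𝟙 _ := by
      have := hd ⟨0, 𝟙 _⟩
      change (N.incl 0 ≫ X.functor.map (𝟙 _)) ≫ d = 𝟙 _ at this
      rwa [X.functor.map_id, Category.comp_id] at this
    refine ⟨d, hd0, h.hom_ext fun σ => ?_⟩
    rw [key σ]
    change (N.incl 0 ≫ X.functor.map (𝟙 _)) ≫ _ = (N.incl 0 ≫ X.functor.map (𝟙 _)) ≫ _
    rw [X.functor.map_id, Category.comp_id, reassoc_of% hd0, Category.comp_id]
  exact ⟨asIso (unitMap X.functor (0 - 0)) ≪≫ (asIso (N.incl 0)).symm, by simp⟩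

/-- Distributivity is applied bead by bead. The empty tensor product is a coproduct with one
summand. -/
lemma isCoprod_map (s : ℕ) (L : List ℕ) : IsCoprod (BeadSurj.map X.functor N.incl s L) := by
  induction L generalizing s with
  | nil =>
    refine ⟨fun hfg => ?_, fun φ => ⟨φ PUnit.unit, fun i => Category.id_comp _⟩⟩
    have := hfg PUnit.unit
    simp only [BeadSurj.map] at this
    rwa [Category.id_comp, Category.id_comp] at this
  | cons t L ih =>
    have : HasColimitsOfSize.{0, 0} V := inferInstance
    exact VQuiv.isCoprod_tensor (N.isCoprod_simplices (t - s)) (ih t)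

/-- The inclusion `X_T^nd → X_T`. -/
def necIncl (T : Necklace) : N.ndNecklace T ⟶ Necklace.tensorBeads (simplices X.functor) T :=
  pathMap N.incl 0 T.jointList

/-- `X_T` is the coproduct of the `X_U^nd` over the surjective necklace maps `f : T → U` with
`U = f(T)`. -/
lemma isCoprod_necklace (T : Necklace) :
    IsCoprod fun f : ActiveSurj T =>
      N.necIncl f.target ≫ (Necklace.necklaceFunctor X.functor).map f.hom.op := by
  have h := (N.isCoprod_map 0 T.jointList).reindex _ ActiveSurj.toBeads_bijective
  obtain ⟨u, hu⟩ := N.exists_iso_zero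
  -- The summand at the tuple of `f` is identified with `X_U^nd` in two steps matching the
  -- factorisation of `X(f)`: `e1` inserts the collapsed beads (inert part), and `e2` treats the
  -- restrictions of `f` (active part).
  have key (f : ActiveSurj T) : ∃ e : N.ndNecklace f.target ≅
      BeadSurj.obj N.nd 0 T.jointList f.toBeads,
      e.hom ≫ BeadSurj.map X.functor N.incl 0 T.jointList f.toBeads =
        N.necIncl f.target ≫ (Necklace.necklaceFunctor X.functor).map f.hom.op := by
    have hf : (0 :: f.target.jointList).Pairwise (· < ·) :=
      List.pairwise_cons.2 ⟨fun t ht => Nat.pos_of_ne_zero (Necklace.mem_jointList.1 ht).1,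
        (Finset.sortedLT_sort _).pairwise⟩
    obtain ⟨e1, h1⟩ := BeadSurj.exists_iso_refine X.functor N.incl u hu 0 f.target.jointList
      (T.jointList.map (FinInt.ev f.hom.toHom)) hf
      (Necklace.pairwise_map _ T.pairwise_jointList) (Necklace.sublist_map f.hom) fun t ht => by
        obtain ⟨x, hx, rfl⟩ := List.mem_map.1 ht
        refine or_iff_not_imp_left.2 fun h0 => Necklace.mem_jointList.2 ⟨h0, ?_⟩
        rw [f.joints]
        exact Finset.mem_image_of_mem _ (Necklace.mem_jointList.1 hx).2
    obtain ⟨e2, h2⟩ := BeadSurj.exists_iso_ofHom X.functor N.incl f.hom.toHom f.surj 0 0 _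
      T.jointList (FinInt.ev_zero _) rfl
    refine ⟨e1 ≪≫ e2, (Category.assoc _ _ _).trans ((congrArg (e1.hom ≫ ·) h2).trans ?_)⟩
    rw [reassoc_of% h1]
    rfl
  choose e he using key
  exact h.of_iso e he

end TemplicialObject.NonDegenerate

/-! ### Flanked flags -/

namespace Necklace

/-- Flags of length `n` on a necklace. -/
abbrev Flag (n : ℕ) (T : Necklace) : Type := (flags.obj T).obj (op (SimplexCategory.mk n))

namespace Flag

variable {n : ℕ} {T U R : Necklace}

/-- The sets of a flag. -/
def sets (x : Flag n T) (i : Fin (n + 1)) : Finset ℕ :=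
  (Functor.obj (show ComposableArrows T.Poset n from x) i).1

/-- The image of a flag under a necklace map. -/
def map (f : T ⟶ U) (x : Flag n T) : Flag n U := (flags.map f).app (op (SimplexCategory.mk n)) x

lemma sets_map (f : T ⟶ U) (x : Flag n T) (i : Fin (n + 1)) :
    (x.map f).sets i = (x.sets i).image (FinInt.ev f.toHom) := rfl

lemma map_id (x : Flag n T) : x.map (𝟙 T) = x := by
  simp only [map, flags.map_id]
  rfl

lemma map_comp (f : T ⟶ U) (g : U ⟶ R) (x : Flag n T) : x.map (f ≫ g) = (x.map f).map g := by
  simp only [map, flags.map_comp]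
  rfl

lemma ext {x y : Flag n T} (h : ∀ i, x.sets i = y.sets i) : x = y :=
  CategoryTheory.Functor.ext (fun i => Subtype.ext (h i)) fun _ _ _ => Subsingleton.elim _ _

lemma sets_mono (x : Flag n T) {i j : Fin (n + 1)} (h : i ≤ j) : x.sets i ⊆ x.sets j :=
  leOfHom ((show ComposableArrows T.Poset n from x).map' i j h
    (Nat.lt_succ_iff.1 j.2))

lemma joints_subset (x : Flag n T) (i : Fin (n + 1)) : T.joints ⊆ x.sets i :=
  (Functor.obj (show ComposableArrows T.Poset n from x) i).2.1

lemma le_last (x : Flag n T) (i : Fin (n + 1)) {t : ℕ} (ht : t ∈ x.sets i) : t ≤ T.last :=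
  (Functor.obj (show ComposableArrows T.Poset n from x) i).2.2 t ht

/-- A flag from an increasing sequence of sets. -/
def mk (A : Fin (n + 1) → Finset ℕ) (hA : Monotone A) (h0 : T.joints ⊆ A 0)
    (h1 : ∀ u ∈ A (Fin.last n), u ≤ T.last) : Flag n T :=
  Monotone.functor (f := fun i : Fin (n + 1) =>
    (⟨A i, h0.trans (hA (Fin.zero_le i)), fun u hu => h1 u (hA (Fin.le_last i) hu)⟩ : T.Poset))
    fun _ _ h => hA h

/-- A flag is flanked if it starts with the joints and ends with all vertices. -/
def IsFlanked (x : Flag n T) : Prop :=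
  x.sets 0 = T.joints ∧ x.sets (Fin.last n) = Finset.range (T.last + 1)

/-- An active surjection sends the joints onto the joints and all vertices onto all vertices, so
both ends of the flag are preserved. -/
lemma IsFlanked.map {x : Flag n T} (hx : x.IsFlanked) (f : ActiveSurj T) :
    (x.map f.hom).IsFlanked := by
  refine ⟨by rw [sets_map, hx.1, f.joints], ?_⟩
  rw [sets_map, hx.2]
  ext j
  simp only [Finset.mem_image, Finset.mem_range, Nat.lt_succ_iff]
  constructor
  · rintro ⟨i, _, rfl⟩
    exact FinInt.ev_le _ _
  · intro hj
    obtain ⟨i, hi, h⟩ := FinInt.exists_ev_of_surjective f.surj hj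
    exact ⟨i, hi, h⟩

/-- A necklace map between flanked flags is an active surjection. -/
def IsFlanked.activeSurj {x : Flag n T} (hx : x.IsFlanked) (f : T ⟶ U)
    (hy : (x.map f).IsFlanked) : ActiveSurj T where
  target := U
  hom := f
  surj := FinInt.surjective_of_exists_ev fun j hj => by
    have : j ∈ (x.map f).sets (Fin.last n) := by
      rw [hy.2]
      exact Finset.mem_range.2 (Nat.lt_succ_of_le hj)
    obtain ⟨i, -, hi⟩ := Finset.mem_image.1 this
    exact ⟨i, hi⟩
  joints := by rw [← hy.1, sets_map, hx.1]

/-- Every flag is the image of a flanked flag, through which all necklace maps from flanked flags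
factor: restrict to the vertices in the last set and take the first set as joints. -/
lemma exists_core (x : Flag n T) : ∃ (R : Necklace) (κ : R ⟶ T) (y : Flag n R),
    y.IsFlanked ∧ y.map κ = x ∧ ∀ {R' : Necklace} (f : R' ⟶ T) (y' : Flag n R'), y'.IsFlanked →
      y'.map f = x → ∃ h : R' ⟶ R, h ≫ κ = f ∧ y'.map h = y := by
  -- `c` numbers the elements of `B` from `0` and `e` enumerates them: inverse order isomorphisms
  -- between `B` and `{0, …, c T.last}`, where `T.last` is the largest element of `B`.
  let B := x.sets (Fin.last n)
  let c := Nat.count (· ∈ B)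
  let e := Nat.nth (· ∈ B)
  have hec {i : ℕ} (hi : i ∈ B) : e (c i) = i := Nat.nth_count hi
  have hB (i : Fin (n + 1)) : x.sets i ⊆ B := x.sets_mono (Fin.le_last i)
  have hTB : T.joints ⊆ B := x.joints_subset _
  have hTl : T.last ∈ B := hTB T.last_mem
  -- `Nat.nth` takes a default value once the finite set `B` is exhausted. This bound ensures that
  -- only genuine elements are enumerated.
  have hlt {i : ℕ} (hi : i ≤ c T.last) (hf : (Set.ofPred (· ∈ B)).Finite) :
      i < hf.toFinset.card := hi.trans_lt (Nat.count_lt_card hf hTl)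
  have hcl {i : ℕ} (hi : i ∈ B) : c i ≤ c T.last := Nat.count_monotone _ (x.le_last _ hi)
  have heB {i : ℕ} (hi : i ≤ c T.last) : e i ∈ B := Nat.nth_mem i (hlt hi)
  have hce {i : ℕ} (hi : i ≤ c T.last) : c (e i) = i := Nat.count_nth (hlt hi)
  have himg (A : Finset ℕ) (hA : A ⊆ B) : (A.image c).image e = A := by
    rw [Finset.image_image]
    exact (Finset.image_congr fun i hi => hec (hA hi)).trans Finset.image_id
  let R : Necklace :=
    { last := c T.last
      joints := (x.sets 0).image c
      zero_mem := Finset.mem_image.2 ⟨0, x.joints_subset _ T.zero_mem, Nat.count_zero _⟩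
      last_mem := Finset.mem_image_of_mem _ (x.joints_subset _ T.last_mem)
      le_last := fun u hu => by
        obtain ⟨t, ht, rfl⟩ := Finset.mem_image.1 hu
        exact hcl (hB _ ht) }
  let κ₀ : R.vertices ⟶ T.vertices := FinInt.homMk e
    (fun _ _ hij hj => Nat.nth_le_nth' hij (hlt hj))
    (Nat.nth_zero_of_zero (hTB T.zero_mem)) (hec hTl)
  have hκ {A : Finset ℕ} (hA : A ⊆ B) : (A.image c).image (FinInt.ev κ₀) = A := by
    refine (Finset.image_congr fun i hi => ?_).trans (himg A hA)
    obtain ⟨t, ht, rfl⟩ := Finset.mem_image.1 hi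
    rw [FinInt.ev_homMk]
    exact congrArg e (min_eq_left (hcl (hA ht)))
  let κ : R ⟶ T := ⟨κ₀, by
    rw [hκ (hB 0)]
    exact x.joints_subset 0⟩
  let y : Flag n R := mk (fun i => (x.sets i).image c)
    (fun i j h => Finset.image_subset_image (x.sets_mono h)) (Finset.Subset.refl _)
    fun u hu => by
      obtain ⟨t, ht, rfl⟩ := Finset.mem_image.1 hu
      exact hcl ht
  refine ⟨R, κ, y, ⟨rfl, ?_⟩, ext fun i => hκ (hB i), fun {R'} f y' hy' hf => ?_⟩
  · change B.image c = Finset.range (c T.last + 1)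
    ext i
    simp only [Finset.mem_image, Finset.mem_range, Nat.lt_succ_iff]
    exact ⟨fun ⟨t, ht, h⟩ => h ▸ hcl ht, fun hi => ⟨e i, heB hi, hce hi⟩⟩
  -- As `y'` ends with all vertices of `R'` and is mapped to `x`, the image of `f` lies in `B`. The
  -- factorisation is therefore `c ∘ f`.
  · have hfB {i : ℕ} (hi : i ≤ R'.last) : FinInt.ev f.toHom i ∈ B := by
      change _ ∈ x.sets (Fin.last n)
      rw [← hf, sets_map, hy'.2]
      exact Finset.mem_image_of_mem _ (Finset.mem_range.2 (Nat.lt_succ_of_le hi))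
    let h₀ : R'.vertices ⟶ R.vertices := FinInt.homMk (fun i => c (FinInt.ev f.toHom i))
      (fun i j hij _ => Nat.count_monotone _ (FinInt.ev_mono _ hij))
      (by rw [FinInt.ev_zero]; exact Nat.count_zero _) (by rw [FinInt.ev_of_le _ le_rfl])
    have hh₀ {i : ℕ} (hi : i ≤ R'.last) : FinInt.ev h₀ i = c (FinInt.ev f.toHom i) := by
      rw [FinInt.ev_homMk, min_eq_left hi]
    have hsets (i : Fin (n + 1)) : (y'.sets i).image (FinInt.ev h₀) = y.sets i := by
      change _ = (x.sets i).image c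
      rw [← hf, sets_map, Finset.image_image]
      exact Finset.image_congr fun t ht => hh₀ (y'.le_last i ht)
    refine ⟨⟨h₀, ?_⟩, hom_ext (FinInt.hom_ext fun i hi => ?_), ext hsets⟩
    -- The factorisation is a necklace map because it sends the first set of `y'`, the joints of
    -- `R'`, onto the first set of `y`, the joints of `R`.
    · rw [← hy'.1, hsets]
      exact Finset.Subset.refl _
    · rw [comp_toHom, FinInt.ev_comp, hh₀ hi, FinInt.ev_homMk,
        min_eq_left (show _ ≤ R.vertices.len from hcl (hfB hi)), hec (hfB hi)]

end Flag

end Necklace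

/-! ### Simplices of the weighted colimit -/

section WeightedColimit

lemma IsCoprod.eval_simplicial {V : Type u} [Category.{v} V] {I : Type*}
    [HasCoproductsOfShape I V] {A : I → SimplicialObject V} {B : SimplicialObject V}
    {ι : ∀ i, A i ⟶ B} (h : IsCoprod ι) (n : ℕ) :
    IsCoprod fun i => (ι i).app (op (SimplexCategory.mk n)) :=
  h.map ((evaluation SimplexCategoryᵒᵖ V).obj (op (SimplexCategory.mk n)))

variable {V : Type u} [Category.{v} V] [MonoidalCategory V] [HasColimits V]

variable (Y : Necklaceᵒᵖ ⥤ V) {n : ℕ}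

/-- The inclusion of `A` in `A ⊗ F(N(P_T)_n)` at a flag. -/
def flagInc (A : V) {T : Necklace} (x : Necklace.Flag n T) :
    A ⟶ (((tensoring V).obj A).obj ((freeFlags V).obj T)).obj (op (SimplexCategory.mk n)) :=
  (ρ_ A).inv ≫ A ◁ Sigma.ι (fun _ : Necklace.Flag n T => 𝟙_ V) x

lemma flagInc_naturality {A B : V} (f : A ⟶ B) {T : Necklace} (x : Necklace.Flag n T) :
    flagInc A x ≫ (((tensoring V).map f).app ((freeFlags V).obj T)).app
        (op (SimplexCategory.mk n)) = f ≫ flagInc B x := by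
  change ((ρ_ A).inv ≫ A ◁ Sigma.ι (fun _ : Necklace.Flag n T => 𝟙_ V) x) ≫ f ▷ _ =
    f ≫ (ρ_ B).inv ≫ B ◁ Sigma.ι (fun _ : Necklace.Flag n T => 𝟙_ V) x
  have e := whisker_exchange f (Sigma.ι (fun _ : Necklace.Flag n T => 𝟙_ V) x)
  rw [Category.assoc]
  exact (congrArg ((ρ_ A).inv ≫ ·) e).trans (rightUnitor_inv_naturality_assoc f _).symm

lemma flagInc_map (A : V) {T U : Necklace} (f : T ⟶ U) (x : Necklace.Flag n T) :
    flagInc A x ≫ (((tensoring V).obj A).map ((freeFlags V).map f)).app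
        (op (SimplexCategory.mk n)) = flagInc A (x.map f) := by
  change ((ρ_ A).inv ≫ A ◁ Sigma.ι (fun _ : Necklace.Flag n T => 𝟙_ V) x) ≫ 
    (A ◁ Limits.Sigma.map' (f := fun _ : Necklace.Flag n T => 𝟙_ V)
      (g := fun _ : Necklace.Flag n U => 𝟙_ V) (Necklace.Flag.map f) fun _ => 𝟙 (𝟙_ V)) = _
  rw [flagInc, Category.assoc, ← MonoidalCategory.whiskerLeft_comp, Sigma.ι_comp_map',
    Category.id_comp]
  rfl

lemma isCoprod_flagInc [MonoidalClosed V] (A : V) (T : Necklace) :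
    IsCoprod fun x : Necklace.Flag n T => flagInc A x :=
  have : HasColimitsOfSize.{0, 0} V := inferInstance
  (IsCoprod.sigma.whiskerLeft A).of_iso (fun _ => (ρ_ A).symm) fun _ => rfl

/-- The simplicial object `Y_T · F N(P_T)`. -/
abbrev weightedTerm (T : Necklace) : SimplicialObject V :=
  ((tensoring V).obj (Y.obj (op T))).obj ((freeFlags V).obj T)

/-- The first morphism in the coequaliser defining the weighted colimit. -/
abbrev weightedFst :
    (∐ fun f : Σ T U : Necklace, T ⟶ U =>
      ((tensoring V).obj (Y.obj (op f.2.1))).obj ((freeFlags V).obj f.1)) ⟶ ∐ weightedTerm Y :=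
  Sigma.desc fun f : Σ T U : Necklace, T ⟶ U =>
    ((tensoring V).map (Y.map f.2.2.op)).app ((freeFlags V).obj f.1) ≫
      Sigma.ι (weightedTerm Y) f.1

/-- The second morphism in the coequaliser defining the weighted colimit. -/
abbrev weightedSnd :
    (∐ fun f : Σ T U : Necklace, T ⟶ U =>
      ((tensoring V).obj (Y.obj (op f.2.1))).obj ((freeFlags V).obj f.1)) ⟶ ∐ weightedTerm Y :=
  Sigma.desc fun f : Σ T U : Necklace, T ⟶ U =>
    ((tensoring V).obj (Y.obj (op f.2.1))).map ((freeFlags V).map f.2.2) ≫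
      Sigma.ι (weightedTerm Y) f.2.1

/-- The quotient morphism to the weighted colimit. -/
def weightedπ : ∐ weightedTerm Y ⟶ weightedColimit Y (freeFlags V) :=
  coequalizer.π (weightedFst Y) (weightedSnd Y)

lemma weighted_condition : weightedFst Y ≫ weightedπ Y = weightedSnd Y ≫ weightedπ Y :=
  coequalizer.condition _ _

/-- Evaluation in degree `n` preserves colimits, so the coequaliser can be tested there. -/
lemma weightedπ_ext {Z : V}
    {g h : (weightedColimit Y (freeFlags V)).obj (op (SimplexCategory.mk n)) ⟶ Z}
    (hgh : (weightedπ Y).app _ ≫ g = (weightedπ Y).app _ ≫ h) : g = h :=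
  Cofork.IsColimit.hom_ext (isColimitOfHasCoequalizerOfPreservesColimit
    ((evaluation SimplexCategoryᵒᵖ V).obj (op (SimplexCategory.mk n)))
    (weightedFst Y) (weightedSnd Y)) hgh

lemma exists_weightedπ_desc {Z : V} (k : (∐ weightedTerm Y).obj (op (SimplexCategory.mk n)) ⟶ Z)
    (hk : (weightedFst Y).app _ ≫ k = (weightedSnd Y).app _ ≫ k) :
    ∃ d : (weightedColimit Y (freeFlags V)).obj (op (SimplexCategory.mk n)) ⟶ Z,
      (weightedπ Y).app _ ≫ d = k :=
  ⟨_, (Cofork.IsColimit.desc' (isColimitOfHasCoequalizerOfPreservesColimit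
    ((evaluation SimplexCategoryᵒᵖ V).obj (op (SimplexCategory.mk n)))
    (weightedFst Y) (weightedSnd Y)) k hk).2⟩

/-- The inclusion of `Y_T` in the `n`-simplices of `∐ Y_T · F N(P_T)` at a flag on `T`. -/
def termInc {T : Necklace} (x : Necklace.Flag n T) :
    Y.obj (op T) ⟶ (∐ weightedTerm Y).obj (op (SimplexCategory.mk n)) :=
  flagInc _ x ≫ (Sigma.ι (weightedTerm Y) T).app _

lemma isCoprod_termInc [MonoidalClosed V] :
    IsCoprod fun p : Σ T : Necklace, Necklace.Flag n T => termInc Y p.2 :=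
  have : HasColimitsOfSize.{0, 0} V := inferInstance
  ((IsCoprod.sigma (A := weightedTerm Y)).eval_simplicial n).comp fun T =>
    isCoprod_flagInc (Y.obj (op T)) T

/-- The inclusion of `Y_U` in the `n`-simplices of `∐ Y_U · F N(P_T)` at a necklace map `T → U` and
a flag on `T`. -/
def relInc {T U : Necklace} (f : T ⟶ U) (x : Necklace.Flag n T) :
    Y.obj (op U) ⟶ (∐ fun f : Σ T U : Necklace, T ⟶ U =>
      ((tensoring V).obj (Y.obj (op f.2.1))).obj ((freeFlags V).obj f.1)).obj
        (op (SimplexCategory.mk n)) :=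
  flagInc _ x ≫ (Sigma.ι (fun f : Σ T U : Necklace, T ⟶ U =>
      ((tensoring V).obj (Y.obj (op f.2.1))).obj ((freeFlags V).obj f.1)) ⟨T, U, f⟩).app _

lemma isCoprod_relInc [MonoidalClosed V] :
    IsCoprod fun p : Σ f : Σ T U : Necklace, T ⟶ U, Necklace.Flag n f.1 =>
      relInc Y p.1.2.2 p.2 :=
  have : HasColimitsOfSize.{0, 0} V := inferInstance
  ((IsCoprod.sigma (A := fun f : Σ T U : Necklace, T ⟶ U =>
    ((tensoring V).obj (Y.obj (op f.2.1))).obj ((freeFlags V).obj f.1))).eval_simplicial n).comp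
      fun f => isCoprod_flagInc (Y.obj (op f.2.1)) f.1

lemma relInc_fst {T U : Necklace} (f : T ⟶ U) (x : Necklace.Flag n T) :
    relInc Y f x ≫ (weightedFst Y).app _ = Y.map f.op ≫ termInc Y x := by
  rw [relInc, Category.assoc, ← NatTrans.comp_app, weightedFst, Sigma.ι_desc, NatTrans.comp_app,
    ← Category.assoc, flagInc_naturality, Category.assoc, termInc]

lemma relInc_snd {T U : Necklace} (f : T ⟶ U) (x : Necklace.Flag n T) :
    relInc Y f x ≫ (weightedSnd Y).app _ = termInc Y (x.map f) := by
  rw [relInc, Category.assoc, ← NatTrans.comp_app, weightedSnd, Sigma.ι_desc, NatTrans.comp_app,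
    ← Category.assoc, flagInc_map, termInc]

/-- The morphism from `Y_T` to the `n`-simplices of the weighted colimit at a flag on `T`. -/
def elementInc {T : Necklace} (x : Necklace.Flag n T) :
    Y.obj (op T) ⟶ (weightedColimit Y (freeFlags V)).obj (op (SimplexCategory.mk n)) :=
  termInc Y x ≫ (weightedπ Y).app _

/-- The only relations imposed by the coequaliser, read on the summand at `(f, x)`: one leg applies
`Y(f)` and keeps the flag, the other keeps `Y_U` and pushes the flag forward. -/
lemma map_elementInc {T U : Necklace} (f : T ⟶ U) (x : Necklace.Flag n T) :
    Y.map f.op ≫ elementInc Y x = elementInc Y (x.map f) := by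
  have := congrArg (fun k => relInc Y f x ≫ k.app _) (weighted_condition Y)
  simp only [NatTrans.comp_app] at this
  rwa [← Category.assoc, relInc_fst, ← Category.assoc, relInc_snd, Category.assoc] at this

lemma element_ext [MonoidalClosed V] {Z : V}
    {g h : (weightedColimit Y (freeFlags V)).obj (op (SimplexCategory.mk n)) ⟶ Z}
    (hgh : ∀ (T : Necklace) (x : Necklace.Flag n T), elementInc Y x ≫ g = elementInc Y x ≫ h) :
    g = h :=
  weightedπ_ext Y <| (isCoprod_termInc Y).hom_ext fun p => by
    simpa only [elementInc, Category.assoc] using hgh p.1 p.2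

/-- With `element_ext` this gives the universal property of the colimit of `(T, x) ↦ Y_T` over the
opposite of the category of elements of flags. -/
lemma exists_element_desc [MonoidalClosed V] {Z : V}
    (φ : ∀ T : Necklace, Necklace.Flag n T → (Y.obj (op T) ⟶ Z))
    (hφ : ∀ {T U : Necklace} (f : T ⟶ U) (x : Necklace.Flag n T),
      Y.map f.op ≫ φ T x = φ U (x.map f)) :
    ∃ d : (weightedColimit Y (freeFlags V)).obj (op (SimplexCategory.mk n)) ⟶ Z,
      ∀ (T : Necklace) (x : Necklace.Flag n T), elementInc Y x ≫ d = φ T x := by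
  obtain ⟨k, hk⟩ := (isCoprod_termInc Y).exists_desc
    fun p : Σ T : Necklace, Necklace.Flag n T => φ p.1 p.2
  obtain ⟨d, hd⟩ := exists_weightedπ_desc Y k <| (isCoprod_relInc Y).hom_ext fun p => by
    rw [← Category.assoc, relInc_fst, ← Category.assoc, relInc_snd, hk ⟨_, p.2.map p.1.2.2⟩,
      Category.assoc, hk ⟨_, p.2⟩, hφ]
  exact ⟨d, fun T x => by rw [elementInc, Category.assoc, hd, hk ⟨T, x⟩]⟩

end WeightedColimit

/-! ### Simplices of the categorification -/

/-- The underlying flag of a flanked flag. -/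
def FlankedFlag.toFlag {n : ℕ} (F : FlankedFlag n) : Necklace.Flag n F.necklace := F.flag

lemma FlankedFlag.isFlanked {n : ℕ} (F : FlankedFlag n) : F.toFlag.IsFlanked := ⟨F.first, F.last⟩

namespace TemplicialObject.NonDegenerate

open Necklace

variable {V : Type u} [Category.{v} V] [MonoidalCategory V] [SymmetricCategory V]
  [MonoidalClosed V] [HasColimits V] {S : Type v} {X : TemplicialObject V S} (N : X.NonDegenerate)
  (a b : S)

/-- The inclusion `X_T^nd(a, b) → X_T(a, b)`. -/
def necInclApp (T : Necklace) : (N.ndNecklace T).obj a b ⟶ (X.nec a b).obj (op T) :=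
  (N.necIncl T).app a b

lemma isCoprod_nec (T : Necklace) :
    IsCoprod fun f : ActiveSurj T => N.necInclApp a b f.target ≫ (X.nec a b).map f.hom.op :=
  have : HasColimitsOfSize.{0, 0} V := inferInstance
  VQuiv.isCoprod_app (N.isCoprod_necklace T) a b

variable {n : ℕ}

/-- The `n`-simplices of the categorification are the coproduct of the `X_T^nd(a, b)` over the
flanked flags. -/
lemma isCoprod_categorification :
    IsCoprod fun F : FlankedFlag n =>
      N.necInclApp a b F.necklace ≫ elementInc (X.nec a b) F.toFlag := by
  refine ⟨fun {Z g h} hgh => element_ext _ fun T x => ?_, fun {Z} φ => ?_⟩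
  -- For uniqueness, an arbitrary flag is pushed forward from a flanked one along `κ`, so its
  -- element factors through the element at the flanked flag.
  · obtain ⟨R, κ, y, hy, rfl, -⟩ := x.exists_core
    rw [← map_elementInc, Category.assoc, Category.assoc]
    congr 1
    -- The summand of `X_R` at `f`, placed at `y`, coincides with the non-degenerate summand at the
    -- flanked flag `f(y)`.
    refine (N.isCoprod_nec a b R).hom_ext fun f => ?_
    have hf := hy.map f
    have := hgh ⟨f.target, y.map f.hom, hf.1, hf.2⟩
    rw [Category.assoc, Category.assoc] at this ⊢
    rw [reassoc_of% (map_elementInc (X.nec a b) f.hom y),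
      reassoc_of% (map_elementInc (X.nec a b) f.hom y)]
    exact this
  · obtain ⟨φ, rfl⟩ : ∃ φ' : ∀ (T : Necklace) (x : Flag n T), x.IsFlanked →
        ((N.ndNecklace T).obj a b ⟶ Z),
        φ = fun F : FlankedFlag n => φ' F.necklace F.toFlag F.isFlanked :=
      ⟨fun T x hx => φ ⟨T, x, hx.1, hx.2⟩, rfl⟩
    -- For existence, the morphism at a flanked flag `x` is forced: its component at an active
    -- surjection `f` is `φ` at `f(x)`.
    have hψ (T : Necklace) (x : Flag n T) (hx : x.IsFlanked) :=
      (N.isCoprod_nec a b T).exists_desc fun f => φ f.target (x.map f.hom) (hx.map f)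
    choose ψ hψ using hψ
    -- Compatibility along maps of flanked flags: the component at `g` is carried to the one at `f ≫
    -- g`, again an active surjection because it relates flanked flags.
    have hψ_map {T U : Necklace} (f : T ⟶ U) (x : Flag n T) (hx : x.IsFlanked) (y : Flag n U)
        (hy : y.IsFlanked) (hxy : x.map f = y) : (X.nec a b).map f.op ≫ ψ T x hx = ψ U y hy := by
      subst hxy
      refine (N.isCoprod_nec a b U).hom_ext fun g => ?_
      let k : ActiveSurj T := hx.activeSurj (f ≫ g.hom) (by
        rw [Flag.map_comp]
        exact hy.map g)
      have e := hψ T x hx k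
      have e' : φ g.target (x.map (f ≫ g.hom)) (hx.map k) =
          φ g.target ((x.map f).map g.hom) (hy.map g) := by
        congr 1
        exact Flag.map_comp _ _ _
      rw [hψ, ← e', ← Category.assoc, Category.assoc _ _ ((X.nec a b).map f.op),
        ← (X.nec a b).map_comp]
      exact e
    have hcore (T : Necklace) (x : Flag n T) := x.exists_core
    choose R κ y hy hyκ hfac using hcore
    -- At a general flag the value is taken through its core. For `f : T → U`, the core of `x` maps
    -- to `f(x)`, hence factors through the core of `f(x)`, and `hψ_map` applies to this
    -- factorisation.
    obtain ⟨d, hd⟩ := exists_element_desc (X.nec a b)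
      (fun T x => (X.nec a b).map (κ T x).op ≫ ψ _ (y T x) (hy T x)) fun {T U} f x => by
        obtain ⟨h, h1, h2⟩ := hfac U (x.map f) (κ T x ≫ f) (y T x) (hy T x) (by
          rw [Flag.map_comp, hyκ])
        rw [← Category.assoc, ← (X.nec a b).map_comp, ← op_comp, ← h1, op_comp,
          (X.nec a b).map_comp, Category.assoc, hψ_map h _ _ _ _ h2]
    refine ⟨d, fun F => ?_⟩
    -- When `F` is itself flanked, its core map relates two flanked flags, so the value agrees with
    -- `ψ` at `F`. The component of `ψ` at the identity is then `φ F`.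
    rw [Category.assoc, hd, hψ_map _ _ _ _ F.isFlanked (hyκ _ _)]
    let i : ActiveSurj F.necklace :=
      ⟨F.necklace, 𝟙 _, Function.surjective_id, (image_id _ _ F.necklace.le_last).symm⟩
    have e := hψ F.necklace F.toFlag F.isFlanked i
    have e' : φ F.necklace (F.toFlag.map (𝟙 _)) (F.isFlanked.map i) =
        φ F.necklace F.toFlag F.isFlanked := by
      congr 1
      exact Flag.map_id _
    have e3 : (X.nec a b).map i.hom.op = 𝟙 _ := (X.nec a b).map_id _
    rw [e3, Category.comp_id] at e
    exact e.trans e'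

end TemplicialObject.NonDegenerate

end Templicial

end

theorem mainTheorem7 {V : Type u} [Category.{v} V] [MonoidalCategory V] [SymmetricCategory V]
    [MonoidalClosed V] [HasLimits V] [HasColimits V] {S : Type v}
    (X : Templicial.TemplicialObject V S) (N : X.NonDegenerate) (n : ℕ) (a b : S) :
    Nonempty ((X.categorification a b).obj (op (SimplexCategory.mk n)) ≅
      ∐ fun T : Templicial.FlankedFlag n => (N.ndNecklace T.necklace).obj a b) :=
  -- Flanked flags form a type in the lowest universe, so the coproduct uses the small colimits
  -- deduced from those of size `v`.
  have : HasColimitsOfSize.{0, 0} V := inferInstance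
  ⟨(N.isCoprod_categorification a b).isColimit.coconePointUniqueUpToIso
    (coproductIsCoproduct _)⟩
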